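/- Let $N\ge 2$, let $\Omega\subset\mathbb{R}^d$ be a nonempty bounded convex open set, let $\mu$ be Lebesgue measure on $\Omega$ normalized to be a probability, and let $u_1,\dots,u_{N-1}:\Omega\to\mathbb{R}^d$ be bounded measurable vector fields. Notation. Let $\sigma(x_1,\dots,x_N)=(x_2,\dots,x_N,x_1)$. $(u_1,\dots,u_{N-1})$ is jointly $N$-monotone on $A\subset\Omega$ if $\sum_{i=1}^N\sum_{\ell=1}^{N-1}\langle u_\ell(x_i),x_i-x_{i+\ell}\rangle\ge 0$ for all $x_1,\dots,x_N\in A$, with $x_{N+i}=x_i$. $\mathcal{P}^\mu_{\rm sym}(\Omega^N)$ is the set of $\sigma$-invariant Borel probability measures on $\Omega^N$ with first marginal $\mu$. $\mathcal{S}_N(\Omega,\mu)$ is the set of $\mu$-measure preserving maps $S:\Omega\to\Omega$ with $S^N=I$ $\mu$-a.e. $\mathcal{H}_N(\Omega)$ is the set of continuous $H:\Omega^N\to\mathbb{R}$ with $\sum_{i=0}^{N-1}H\circ\sigma^i=0$ on $\Omega^N$. A function $H:\Omega^N\to\mathbb{R}$ is $N$-sub-antisymmetric if $\sum_{i=0}^{N-1}H\circ\sigma^i\le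 0$ on $\Omega^N$. For $H:\Omega^N\to\mathbb{R}$, $x\in\Omega$ and $p_1,\dots,p_{N-1}\in\mathbb{R}^d$, $$L_H(x,p_1,\dots,p_{N-1})=\sup\Big\{\sum_{i=1}^{N-1}\langle p_i,y_i\rangle-H(x,y_1,\dots,y_{N-1});\ y_1,\dots,y_{N-1}\in\Omega\Big\}\in(-\infty,+\infty],$$ and $H_{2,\dots,N}$ denotes the concavification of $\sum_{i=1}^{N-1}H\circ\sigma^i$ with respect to the last $N-1$ variables jointly (the supremum of its averages over finite convex combinations of points of $\Omega^{N-1}$ equal to $(x_2,\dots,x_N)$, with $x_1$ fixed). The following properties are equivalent: 1. There is a set $\Omega_0$ of measure zero such that $(u_1,\dots,u_{N-1})$ is jointly $N$-monotone on $\Omega\setminus\Omega_0$. 2. $\inf\big\{\int_{\Omega^N}\sum_{\ell=1}^{N-1}\langle u_\ell(x_1),x_1-x_{\ell+1}\rangle\,d\pi(x_1,\dots,x_N);\ \pi\in\mathcal{P}^\mu_{\rm sym}(\Omega^N)\big\}=0$, and this infimum is attained by the push-forward of $\mu$ under $x\mapsto(x,x,\dots,x)$. 3. $\inf\big\{\int_\Omega\sum_{\ell=1}^{N-1}\langle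 u_\ell(x),x-S^\ell x\rangle\,d\mu;\ S\in\mathcal{S}_N(\Omega,\mu)\big\}=0$. 4. $\inf\big\{\int_\Omega\sum_{\ell=1}^{N-1}|u_\ell(x)-S^\ell x|^2\,d\mu;\ S\in\mathcal{S}_N(\Omega,\mu)\big\}=\sum_{\ell=1}^{N-1}\int_\Omega|u_\ell(x)-x|^2\,d\mu$. 5. There is an $N$-sub-antisymmetric $H:\Omega^N\to\mathbb{R}$, concave in the first variable, jointly convex in the last $N-1$ variables and zero on the diagonal, such that $(u_1(x),\dots,u_{N-1}(x))=\nabla_{2,\dots,N}H(x,x,\dots,x)$ for a.e. $x\in\Omega$, and such that moreover $H+H_{2,\dots,N}=0$ on $\Omega^N$. 6. $\inf\big\{\int_\Omega L_H(x,u_1(x),\dots,u_{N-1}(x))\,d\mu;\ H\in\mathcal{H}_N(\Omega)\big\}=\sup\big\{\int_\Omega\sum_{\ell=1}^{N-1}\langle u_\ell(x),S^\ell x\rangle\,d\mu;\ S\in\mathcal{S}_N(\Omega,\mu)\big\}$, and the supremum is attained at the identity map. -/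

import Mathlib

open MeasureTheory
open scoped ENNReal

noncomputable section

namespace NMonotone

/-- The space `ℝᵈ` with its Euclidean structure. -/
abbrev E (d : ℕ) := EuclideanSpace ℝ (Fin d)

/-! Throughout `N = n + 1`; the coordinates `x_1, …, x_N` of an `N`-tuple are indexed by
`Fin (n + 1)`, whose addition is cyclic, and the fields `u_1, …, u_{N-1}` by `Fin n`. The
element `ℓ : Fin n` stands for the index `ℓ + 1`, so that `ℓ.succ : Fin (n + 1)` is the
corresponding shift. -/

variable {d n : ℕ}

/-- The tuple `u` is jointly `N`-monotone on `A`. -/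
def JointlyMonotoneOn (u : Fin n → E d → E d) (A : Set (E d)) : Prop :=
  ∀ x : Fin (n + 1) → E d, (∀ i, x i ∈ A) →
    0 ≤ ∑ i : Fin (n + 1), ∑ ℓ : Fin n, inner ℝ (u ℓ (x i)) (x i - x (i + ℓ.succ))

/-- The cyclic permutation `σ (x_1, …, x_N) = (x_2, …, x_N, x_1)`. -/
def cyc (x : Fin (n + 1) → E d) : Fin (n + 1) → E d := fun i => x (i + 1)

/-- The product `Ω ^ m`. -/
def power (Ω : Set (E d)) (m : ℕ) : Set (Fin m → E d) := {x | ∀ i, x i ∈ Ω}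

/-- Continuous `N`-antisymmetric Hamiltonians on `Ω ^ N` (only the values on `Ω ^ N` matter). -/
def antisymmetricHamiltonians (n : ℕ) (Ω : Set (E d)) : Set ((Fin (n + 1) → E d) → ℝ) :=
  {H | ContinuousOn H (power Ω (n + 1)) ∧
    ∀ x ∈ power Ω (n + 1), ∑ i ∈ Finset.range (n + 1), H (cyc^[i] x) = 0}

/-- `N`-sub-antisymmetric functions on `Ω ^ N`. -/
def SubAntisymmetric (Ω : Set (E d)) (H : (Fin (n + 1) → E d) → ℝ) : Prop :=
  ∀ x ∈ power Ω (n + 1), ∑ i ∈ Finset.range (n + 1), H (cyc^[i] x) ≤ 0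

/-- The functional `L_H (x, p_1, …, p_{N-1})`, a supremum over `Ω ^ (N-1)` which may be `+∞`. -/
def legendre (Ω : Set (E d)) (H : (Fin (n + 1) → E d) → ℝ) (x : E d) (p : Fin n → E d) :
    EReal :=
  ⨆ y ∈ power Ω n, (((∑ i, inner ℝ (p i) (y i)) - H (Fin.cons x y) : ℝ) : EReal)

/-- The integral of an extended-real-valued function: integral of the positive part minus
integral of the negative part. -/
def extIntegral {X : Type*} [MeasurableSpace X] (μ : Measure X) (f : X → EReal) : EReal :=
  ((∫⁻ x, (f x).toENNReal ∂μ : ℝ≥0∞) : EReal) - ((∫⁻ x, (-f x).toENNReal ∂μ : ℝ≥0∞) : EReal)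

/-- The concavification on `A` of `g`: the supremum of `∑ λ_k g(y_k)` over the finite convex
combinations `y = ∑ λ_k y_k` of points of `A`. -/
def concavification {V : Type*} [AddCommGroup V] [Module ℝ V] (A : Set V) (g : V → ℝ) (y : V) :
    EReal :=
  sSup {r : EReal | ∃ (m : ℕ) (w : Fin m → ℝ) (z : Fin m → V), (∀ k, 0 ≤ w k) ∧
    ∑ k, w k = 1 ∧ (∀ k, z k ∈ A) ∧ ∑ k, w k • z k = y ∧ r = ((∑ k, w k * g (z k) : ℝ) : EReal)}

/-- The function `H_{2,…,N}`: the concavification, with respect to the last `N - 1` variables,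
of `∑_{i=1}^{N-1} H ∘ σ ^ i`. -/
def partialConcavification (Ω : Set (E d)) (H : (Fin (n + 1) → E d) → ℝ)
    (x : Fin (n + 1) → E d) : EReal :=
  concavification (power Ω n)
    (fun y : Fin n → E d => ∑ i ∈ Finset.Icc 1 n, H (cyc^[i] (Fin.cons (x 0) y))) (Fin.tail x)

/-- `(p_1, …, p_{N-1}) = ∇_{2,…,N} H (x, x, …, x)`. -/
def HasDiagonalGradient (H : (Fin (n + 1) → E d) → ℝ) (p : Fin n → E d) (x : E d) : Prop :=
  HasFDerivAt (fun y : Fin n → E d => H (Fin.cons x y))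
    (∑ ℓ : Fin n, (innerSL ℝ (p ℓ)).comp (ContinuousLinearMap.proj (R := ℝ) ℓ))
    (fun _ : Fin n => x)

/-- Lebesgue measure on `Ω`, normalized to a probability measure. -/
def normLebesgue (Ω : Set (E d)) : Measure (E d) := ProbabilityTheory.cond volume Ω

/-- The `σ`-invariant probability measures on `Ω ^ N` whose first marginal is `μ`. -/
def symmetricPlans (n : ℕ) (Ω : Set (E d)) (μ : Measure (E d)) :
    Set (Measure (Fin (n + 1) → E d)) :=
  {π | IsProbabilityMeasure π ∧ (∀ᵐ x ∂π, x ∈ power Ω (n + 1)) ∧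
    π.map cyc = π ∧ π.map (fun x => x 0) = μ}

/-- The `μ`-measure preserving `S : Ω → Ω` with `S ^ N = I` `μ`-a.e. -/
def involutions (n : ℕ) (Ω : Set (E d)) (μ : Measure (E d)) : Set (E d → E d) :=
  {S | Set.MapsTo S Ω Ω ∧ MeasurePreserving S μ μ ∧ ∀ᵐ x ∂μ, S^[n + 1] x = x}

/-- The Monge–Kantorovich cost of a plan `π`. -/
def planCost (u : Fin n → E d → E d) (π : Measure (Fin (n + 1) → E d)) : ℝ :=
  ∫ x, ∑ ℓ : Fin n, inner ℝ (u ℓ (x 0)) (x 0 - x ℓ.succ) ∂π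

end NMonotone

end

open NMonotone

/-! Put `f (x_1, …, x_N) = ∑ ⟨u_ℓ x_1, x_{ℓ+1} - x_1⟩`. Joint monotonicity says that the sum of `f`
over the cyclic rotations of a tuple is nonpositive, and every other property is compared with this
one.

A symmetric plan does not see rotations, so `N` times its cost is the integral of a nonnegative
cyclic sum (`planCost_nonneg`). Orbits `(x, S x, …, S^{N-1} x)` push `μ` to symmetric plans, which
gives (3). Since `S` preserves `μ`, expanding the squares shows that (3) and (4) differ only by a
factor 2 and a constant. To come back to (1), take Lebesgue points `x_1, …, x_N` and let `S`
translate small disjoint balls cyclically near them: the cost of `S`, divided by the volume of a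
ball, tends to the cyclic sum at these points (`exists_jointlyMonotoneOn`). The same argument
applies to (6), of which only the optimality of the identity is needed.

From (1) to (5), `generated` concavifies `f` in its first variable. The cyclic sum is affine in each
graph point separately, so its sign survives the passage to convex hulls (`cyclicSum_nonpos`), and
the result is a sub-antisymmetric saddle function. Replacing `H` by `(n H - H_{2,…,N}) / (n + 1)`
keeps that structure and increases `H`; the iterates are bounded by minus the other rotations of
`H`, and their limit satisfies `H + H_{2,…,N} = 0`. Such a function lies above `f`, while
sub-antisymmetry bounds it above by minus its rotations, which to first order near the diagonal is
`f` again; this squeeze gives the gradient wherever `u` is approximately continuous. Conversely, (5)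
returns `f` as a minorant by the tangent inequality, and summing over rotations gives (1).

For (6), an antisymmetric `H` vanishes on the diagonal, hence `L_H ≥ ∑ ⟨u_ℓ x, x⟩`. Antisymmetrizing
`generated` yields a continuous `H` above `f`, for which equality holds almost everywhere. -/

namespace NMonotone

/-! ### Cyclic rotations -/

section Rotations

variable {d n : ℕ}

/-- The rotation of an `N`-tuple by `i` places. -/
def rot (i : Fin (n + 1)) (x : Fin (n + 1) → E d) : Fin (n + 1) → E d := fun j => x (j + i)

@[simp] theorem rot_apply (i j : Fin (n + 1)) (x : Fin (n + 1) → E d) : rot i x j = x (j + i) := rfl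

@[simp] theorem rot_zero (x : Fin (n + 1) → E d) : rot 0 x = x := by ext1 j; simp

theorem rot_rot (i j : Fin (n + 1)) (x : Fin (n + 1) → E d) : rot i (rot j x) = rot (i + j) x := by
  ext1 k; simp [add_assoc]

theorem rot_const (i : Fin (n + 1)) (x : E d) : rot i (fun _ => x) = fun _ => x := rfl

theorem rot_mem_power {Ω : Set (E d)} {x : Fin (n + 1) → E d} (hx : x ∈ power Ω (n + 1))
    (i : Fin (n + 1)) : rot i x ∈ power Ω (n + 1) := fun j => hx (j + i)

theorem cyc_iterate_eq_rot (k : ℕ) (x : Fin (n + 1) → E d) :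
    cyc^[k] x = rot (Fin.ofNat (n + 1) k) x := by
  induction k with
  | zero => ext1 j; simp [rot]
  | succ k ih =>
    rw [Function.iterate_succ_apply', ih]
    ext1 j
    simp only [cyc, rot_apply, add_assoc]
    congr 2
    ext
    simp [Fin.val_add, add_comm]

theorem cyc_iterate_val (i : Fin (n + 1)) (x : Fin (n + 1) → E d) : cyc^[(i : ℕ)] x = rot i x := by
  rw [cyc_iterate_eq_rot]; congr 1; ext; simp

theorem sum_range_cyc (H : (Fin (n + 1) → E d) → ℝ) (x : Fin (n + 1) → E d) :
    ∑ i ∈ Finset.range (n + 1), H (cyc^[i] x) = ∑ i : Fin (n + 1), H (rot i x) := by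
  rw [Finset.sum_range]
  simp only [cyc_iterate_val]

/-- The function `∑_{i=1}^{N-1} H ∘ σ ^ i`. -/
def others (H : (Fin (n + 1) → E d) → ℝ) (x : Fin (n + 1) → E d) : ℝ :=
  ∑ ℓ : Fin n, H (rot ℓ.succ x)

theorem sum_rot_eq (H : (Fin (n + 1) → E d) → ℝ) (x : Fin (n + 1) → E d) :
    ∑ i : Fin (n + 1), H (rot i x) = H x + others H x := by
  rw [Fin.sum_univ_succ, rot_zero, others]

theorem sum_Icc_cyc (H : (Fin (n + 1) → E d) → ℝ) (x : Fin (n + 1) → E d) :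
    ∑ i ∈ Finset.Icc 1 n, H (cyc^[i] x) = others H x := by
  have h := sum_range_cyc H x
  rw [sum_rot_eq, Finset.sum_range_succ'] at h
  have h2 : ∑ i ∈ Finset.Icc 1 n, H (cyc^[i] x) = ∑ i ∈ Finset.range n, H (cyc^[i + 1] x) := by
    rw [← Finset.Ico_add_one_right_eq_Icc, Finset.sum_Ico_eq_sum_range]
    simp [add_comm]
  rw [h2]
  simpa [add_comm] using h

theorem sum_rot_rot (H : (Fin (n + 1) → E d) → ℝ) (x : Fin (n + 1) → E d) (j : Fin (n + 1)) :
    ∑ i : Fin (n + 1), H (rot j (rot i x)) = ∑ i : Fin (n + 1), H (rot i x) := by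
  simp only [rot_rot]
  exact Fintype.sum_equiv (Equiv.addLeft j) _ _ (fun _ => rfl)

theorem sum_others_rot (H : (Fin (n + 1) → E d) → ℝ) (x : Fin (n + 1) → E d) :
    ∑ i : Fin (n + 1), others H (rot i x) = n * ∑ i : Fin (n + 1), H (rot i x) := by
  simp only [others]
  rw [Finset.sum_comm]
  simp only [sum_rot_rot]
  simp

theorem subAntisymmetric_iff {Ω : Set (E d)} {H : (Fin (n + 1) → E d) → ℝ} :
    SubAntisymmetric Ω H ↔ ∀ x ∈ power Ω (n + 1), ∑ i : Fin (n + 1), H (rot i x) ≤ 0 := by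
  simp only [SubAntisymmetric, sum_range_cyc]

theorem cons_mem_power {Ω : Set (E d)} {x : E d} {y : Fin n → E d} (hx : x ∈ Ω)
    (hy : y ∈ power Ω n) : (Fin.cons x y : Fin (n + 1) → E d) ∈ power Ω (n + 1) := by
  intro i
  refine Fin.cases ?_ (fun j => ?_) i
  · simpa using hx
  · simpa using hy j

theorem tail_mem_power {Ω : Set (E d)} {x : Fin (n + 1) → E d} (hx : x ∈ power Ω (n + 1)) :
    Fin.tail x ∈ power Ω n := fun i => hx i.succ

theorem cons_const (x : E d) :
    (Fin.cons x (fun _ => x : Fin n → E d) : Fin (n + 1) → E d) = fun _ => x := by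
  ext1 i
  refine Fin.cases ?_ (fun j => ?_) i <;> simp

theorem convex_power {Ω : Set (E d)} (hΩ : Convex ℝ Ω) (m : ℕ) : Convex ℝ (power Ω m) :=
  fun _ hx _ hy _ _ ha hb hab i => hΩ (hx i) (hy i) ha hb hab

theorem isOpen_power {Ω : Set (E d)} (hΩ : IsOpen Ω) (m : ℕ) : IsOpen (power Ω m) := by
  have : power Ω m = Set.univ.pi fun _ => Ω := by ext; simp [power]
  rw [this]
  exact isOpen_set_pi Set.finite_univ fun _ _ => hΩ

end Rotations

/-! ### Concavification -/

section Concavification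

variable {V : Type*} [AddCommGroup V] [Module ℝ V]

/-- The values at `y` of the convex combinations of points of the graph of `g` over `A`. -/
def hullValues (A : Set V) (g : V → ℝ) (y : V) : Set ℝ :=
  {r | (y, r) ∈ convexHull ℝ ((fun z => (z, g z)) '' A)}

theorem mem_hullValues_iff {A : Set V} {g : V → ℝ} {y : V} {r : ℝ} :
    r ∈ hullValues A g y ↔ ∃ (m : ℕ) (w : Fin m → ℝ) (z : Fin m → V), (∀ k, 0 ≤ w k) ∧
      ∑ k, w k = 1 ∧ (∀ k, z k ∈ A) ∧ ∑ k, w k • z k = y ∧ r = ∑ k, w k * g (z k) := by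
  constructor
  · intro h
    obtain ⟨ι, _, w, f, hw, hw1, hf, hs⟩ := mem_convexHull_iff_exists_fintype.1 h
    choose z hz hzf using hf
    have e := (Fintype.equivFin ι).symm
    refine ⟨Fintype.card ι, w ∘ e, z ∘ e, fun k => hw _, ?_, fun k => hz _, ?_, ?_⟩
    · rw [← hw1]; exact Equiv.sum_comp e w
    · have h1 : ∑ i, w i • z i = y := by
        have := congrArg Prod.fst hs
        simpa [Prod.fst_sum, ← hzf] using this
      rw [← h1]; exact Equiv.sum_comp e (fun i => w i • z i)
    · have h1 : ∑ i, w i * g (z i) = r := by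
        have := congrArg Prod.snd hs
        simpa [Prod.snd_sum, ← hzf] using this
      rw [← h1]; exact (Equiv.sum_comp e (fun i => w i * g (z i))).symm
  · rintro ⟨m, w, z, hw, hw1, hz, hy, hr⟩
    refine mem_convexHull_of_exists_fintype w (fun k => (z k, g (z k))) hw hw1
      (fun k => ⟨z k, hz k, rfl⟩) ?_
    ext
    · simpa [Prod.fst_sum] using hy
    · simpa [Prod.snd_sum] using hr.symm

theorem concavification_eq_sSup (A : Set V) (g : V → ℝ) (y : V) :
    concavification A g y = sSup ((fun r : ℝ => (r : EReal)) '' hullValues A g y) := by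
  unfold concavification
  congr 1
  ext r
  constructor
  · rintro ⟨m, w, z, hw, hw1, hz, hy, hr⟩
    exact ⟨_, mem_hullValues_iff.2 ⟨m, w, z, hw, hw1, hz, hy, rfl⟩, hr.symm⟩
  · rintro ⟨s, hs, rfl⟩
    obtain ⟨m, w, z, hw, hw1, hz, hy, hr⟩ := mem_hullValues_iff.1 hs
    exact ⟨m, w, z, hw, hw1, hz, hy, by simp [hr]⟩

/-- The real-valued concavification. -/
noncomputable def realConcavification (A : Set V) (g : V → ℝ) (y : V) : ℝ := sSup (hullValues A g y)

theorem self_mem_hullValues {A : Set V} {g : V → ℝ} {y : V} (hy : y ∈ A) :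
    g y ∈ hullValues A g y := subset_convexHull ℝ _ ⟨y, hy, rfl⟩

theorem concavification_eq_coe {A : Set V} {g : V → ℝ} {y : V} (hy : y ∈ A)
    (hb : BddAbove (hullValues A g y)) :
    concavification A g y = (realConcavification A g y : EReal) := by
  have hl : IsLUB (hullValues A g y) (realConcavification A g y) :=
    isLUB_csSup ⟨_, self_mem_hullValues hy⟩ hb
  rw [concavification_eq_sSup]
  refine IsLUB.sSup_eq ⟨?_, fun c hc => ?_⟩
  · rintro _ ⟨r, hr, rfl⟩
    exact EReal.coe_le_coe_iff.2 (hl.1 hr)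
  · induction c with
    | bot => simpa using hc ⟨_, self_mem_hullValues hy, rfl⟩
    | top => exact le_top
    | coe c =>
      exact EReal.coe_le_coe_iff.2 (hl.2 fun r hr => EReal.coe_le_coe_iff.1 (hc ⟨r, hr, rfl⟩))

theorem le_realConcavification {A : Set V} {g : V → ℝ} {y : V} (hy : y ∈ A)
    (hb : BddAbove (hullValues A g y)) : g y ≤ realConcavification A g y :=
  le_csSup hb (self_mem_hullValues hy)

/-- A concave majorant of `g` bounds all convex combinations of values of `g`. -/
theorem le_of_mem_hullValues {A : Set V} {g k : V → ℝ} (hk : ConcaveOn ℝ A k)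
    (hgk : ∀ z ∈ A, g z ≤ k z) {y : V} {r : ℝ} (hr : r ∈ hullValues A g y) : r ≤ k y := by
  obtain ⟨m, w, z, hw, hw1, hz, rfl, rfl⟩ := mem_hullValues_iff.1 hr
  calc ∑ i, w i * g (z i) ≤ ∑ i, w i * k (z i) :=
        Finset.sum_le_sum fun i _ => mul_le_mul_of_nonneg_left (hgk _ (hz i)) (hw i)
    _ ≤ k (∑ i, w i • z i) := by
        simpa using hk.le_map_sum (t := Finset.univ) (fun i _ => hw i) hw1 (fun i _ => hz i)

/-- The upper boundary of a convex set in `W × ℝ` is concave. This serves both the envelope in the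
last variables and the generated function in the first. -/
theorem concaveOn_sSup_of_convex {W : Type*} [AddCommGroup W] [Module ℝ W] {A : Set W}
    (hA : Convex ℝ A) {G : Set (W × ℝ)} (hG : Convex ℝ G)
    (hne : ∀ y ∈ A, {r | (y, r) ∈ G}.Nonempty) (hb : ∀ y ∈ A, BddAbove {r | (y, r) ∈ G}) :
    ConcaveOn ℝ A fun y => sSup {r | (y, r) ∈ G} := by
  refine ⟨hA, fun x hx y hy a b ha hb' hab => ?_⟩
  have hxy := hA hx hy ha hb' hab
  refine le_of_forall_pos_le_add fun ε hε => ?_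
  obtain ⟨r, hr, hr'⟩ := exists_lt_of_lt_csSup (hne x hx) (sub_lt_self _ hε)
  obtain ⟨s, hs, hs'⟩ := exists_lt_of_lt_csSup (hne y hy) (sub_lt_self _ hε)
  have h1 : a * r + b * s ≤ sSup {t | (a • x + b • y, t) ∈ G} :=
    le_csSup (hb _ hxy) (by simpa using hG hr hs ha hb' hab)
  have h2 := mul_le_mul_of_nonneg_left hr'.le ha
  have h3 := mul_le_mul_of_nonneg_left hs'.le hb'
  simp only [smul_eq_mul]
  have : ε = a * ε + b * ε := by rw [← add_mul, hab, one_mul]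
  nlinarith

theorem concaveOn_realConcavification {A : Set V} (hA : Convex ℝ A) {g : V → ℝ}
    (hb : ∀ y ∈ A, BddAbove (hullValues A g y)) : ConcaveOn ℝ A (realConcavification A g) :=
  concaveOn_sSup_of_convex hA (convex_convexHull ℝ _) (fun _ hy => ⟨_, self_mem_hullValues hy⟩) hb

/-- One and the same convex combination of points competes in all three suprema. This transfers
convexity in the frozen variable `x_1` from `g` to its envelope. -/
theorem realConcavification_le_combo {A : Set V} {g g₁ g₂ : V → ℝ} {a b : ℝ} (ha : 0 ≤ a)
    (hb : 0 ≤ b) {y : V} (hy : y ∈ A) (hg : ∀ z ∈ A, g z ≤ a * g₁ z + b * g₂ z)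
    (h₁ : BddAbove (hullValues A g₁ y)) (h₂ : BddAbove (hullValues A g₂ y)) :
    realConcavification A g y ≤ a * realConcavification A g₁ y + b * realConcavification A g₂ y := by
  refine csSup_le ⟨_, self_mem_hullValues hy⟩ fun r hr => ?_
  obtain ⟨m, w, z, hw, hw1, hz, hzy, rfl⟩ := mem_hullValues_iff.1 hr
  have e₁ := le_csSup h₁ (mem_hullValues_iff.2 ⟨m, w, z, hw, hw1, hz, hzy, rfl⟩)
  have e₂ := le_csSup h₂ (mem_hullValues_iff.2 ⟨m, w, z, hw, hw1, hz, hzy, rfl⟩)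
  calc ∑ k, w k * g (z k) ≤ ∑ k, w k * (a * g₁ (z k) + b * g₂ (z k)) :=
        Finset.sum_le_sum fun i _ => mul_le_mul_of_nonneg_left (hg _ (hz i)) (hw i)
    _ = a * ∑ k, w k * g₁ (z k) + b * ∑ k, w k * g₂ (z k) := by
        rw [Finset.mul_sum, Finset.mul_sum, ← Finset.sum_add_distrib]
        exact Finset.sum_congr rfl fun i _ => by ring
    _ ≤ _ := add_le_add (mul_le_mul_of_nonneg_left e₁ ha) (mul_le_mul_of_nonneg_left e₂ hb)

theorem realConcavification_mono {A : Set V} {g g₁ : V → ℝ} {y : V} (hy : y ∈ A)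
    (hg : ∀ z ∈ A, g z ≤ g₁ z) (h₁ : BddAbove (hullValues A g₁ y)) :
    realConcavification A g y ≤ realConcavification A g₁ y := by
  simpa using realConcavification_le_combo (a := 1) (b := 0) zero_le_one le_rfl hy
    (by simpa using hg) h₁ h₁

end Concavification

end NMonotone

namespace NMonotone

/-! ### Sub-antisymmetric saddle functions -/

section Saddle

open Filter Topology

variable {d n : ℕ} {Ω : Set (E d)}

/-- `N`-sub-antisymmetric functions, concave in the first variable and jointly convex in the
last `N - 1` variables. -/
structure IsSubSaddle (Ω : Set (E d)) (H : (Fin (n + 1) → E d) → ℝ) : Prop where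
  sub : SubAntisymmetric Ω H
  concave : ∀ y ∈ power Ω n, ConcaveOn ℝ Ω (fun x => H (Fin.cons x y))
  convex : ∀ x ∈ Ω, ConvexOn ℝ (power Ω n) (fun y => H (Fin.cons x y))

/-- The real-valued version of `partialConcavification`. -/
noncomputable def envelope (Ω : Set (E d)) (H : (Fin (n + 1) → E d) → ℝ)
    (x : Fin (n + 1) → E d) : ℝ :=
  realConcavification (power Ω n) (fun y => others H (Fin.cons (x 0) y)) (Fin.tail x)

/-- Half-way step from `H` towards `-H_{2,…,N}`, keeping the saddle property. -/
noncomputable def improve (Ω : Set (E d)) (H : (Fin (n + 1) → E d) → ℝ)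
    (x : Fin (n + 1) → E d) : ℝ :=
  (n * H x - envelope Ω H x) / (n + 1)

/-- A nontrivial rotation moves `x_1` into one of the last `N - 1` slots and fixes all other
entries, so convexity of `H` in those slots applies term by term. -/
theorem others_smul_combo_le {H : (Fin (n + 1) → E d) → ℝ}
    (hconv : ∀ x ∈ Ω, ConvexOn ℝ (power Ω n) (fun y => H (Fin.cons x y)))
    {x x' : E d} (hx : x ∈ Ω) (hx' : x' ∈ Ω) {y : Fin n → E d} (hy : y ∈ power Ω n) {a b : ℝ}
    (ha : 0 ≤ a) (hb : 0 ≤ b) (hab : a + b = 1) :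
    others H (Fin.cons (a • x + b • x') y) ≤
      a * others H (Fin.cons x y) + b * others H (Fin.cons x' y) := by
  simp only [others, Finset.mul_sum, ← Finset.sum_add_distrib]
  refine Finset.sum_le_sum fun ℓ _ => ?_
  have key : ∀ t : E d, rot ℓ.succ (Fin.cons t y : Fin (n + 1) → E d) =
      Fin.cons (y ℓ) (Fin.tail (rot ℓ.succ (Fin.cons t y : Fin (n + 1) → E d))) := by
    intro t
    conv_lhs => rw [← Fin.cons_self_tail (rot ℓ.succ (Fin.cons t y : Fin (n + 1) → E d))]
    simp [rot]
  have htail : ∀ t ∈ Ω, Fin.tail (rot ℓ.succ (Fin.cons t y : Fin (n + 1) → E d)) ∈ power Ω n :=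
    fun t ht => tail_mem_power (rot_mem_power (cons_mem_power ht hy) _)
  have hc := (hconv (y ℓ) (hy ℓ)).2 (htail x hx) (htail x' hx') ha hb hab
  rw [key (a • x + b • x'), key x, key x']
  simp only [smul_eq_mul] at hc
  convert hc using 3
  ext1 j
  simp only [Fin.tail, rot_apply, Pi.add_apply, Pi.smul_apply]
  -- Index `0` carries the moving entry; any other entry is constant, equal to its own convex
  -- combination.
  refine Fin.cases ?_ (fun k => ?_) (j.succ + ℓ.succ)
  · simp
  · simp [← add_smul, hab]

namespace IsSubSaddle

variable {H : (Fin (n + 1) → E d) → ℝ}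

theorem others_le_neg (hH : SubAntisymmetric Ω H) {x : Fin (n + 1) → E d}
    (hx : x ∈ power Ω (n + 1)) : others H x ≤ -H x := by
  have := subAntisymmetric_iff.1 hH x hx
  rw [sum_rot_eq] at this
  linarith

theorem le_neg_of_mem_hullValues (hH : IsSubSaddle Ω H) {x : E d} (hx : x ∈ Ω) {y : Fin n → E d}
    {r : ℝ} (hr : r ∈ hullValues (power Ω n) (fun y => others H (Fin.cons x y)) y) :
    r ≤ -H (Fin.cons x y) :=
  le_of_mem_hullValues (hH.convex x hx).neg
    (fun _ hz => others_le_neg hH.sub (cons_mem_power hx hz)) hr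

theorem bddAbove_hullValues (hH : IsSubSaddle Ω H) {x : E d} (hx : x ∈ Ω) (y : Fin n → E d) :
    BddAbove (hullValues (power Ω n) (fun y => others H (Fin.cons x y)) y) :=
  ⟨_, fun _ hr => hH.le_neg_of_mem_hullValues hx hr⟩

theorem envelope_le_neg (hH : IsSubSaddle Ω H) {x : Fin (n + 1) → E d}
    (hx : x ∈ power Ω (n + 1)) : envelope Ω H x ≤ -H x := by
  refine csSup_le ⟨_, self_mem_hullValues (tail_mem_power hx)⟩ fun r hr => ?_
  simpa using hH.le_neg_of_mem_hullValues (hx 0) hr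

theorem others_le_envelope (hH : IsSubSaddle Ω H) {x : Fin (n + 1) → E d}
    (hx : x ∈ power Ω (n + 1)) : others H x ≤ envelope Ω H x := by
  simpa [envelope] using le_realConcavification (tail_mem_power hx)
    (hH.bddAbove_hullValues (hx 0) (Fin.tail x))

theorem partialConcavification_eq (hH : IsSubSaddle Ω H) {x : Fin (n + 1) → E d}
    (hx : x ∈ power Ω (n + 1)) : partialConcavification Ω H x = (envelope Ω H x : EReal) := by
  unfold partialConcavification
  simp only [sum_Icc_cyc]
  exact concavification_eq_coe (tail_mem_power hx) (hH.bddAbove_hullValues (hx 0) _)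

theorem envelope_cons (x : E d) (y : Fin n → E d) :
    envelope Ω H (Fin.cons x y) =
      realConcavification (power Ω n) (fun y => others H (Fin.cons x y)) y := by
  simp [envelope]

theorem le_improve (hH : IsSubSaddle Ω H) {x : Fin (n + 1) → E d}
    (hx : x ∈ power Ω (n + 1)) : H x ≤ improve Ω H x := by
  have := hH.envelope_le_neg hx
  rw [improve, le_div_iff₀ (by positivity)]
  linarith

/-- The weight `n` is forced by sub-antisymmetry: summed over rotations, the envelope is at least `∑
others H = n ∑ H ∘ σ^i`, which cancels the contribution of `n * H`. The envelope is convex in `x_1`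
and concave in the rest, so subtracting it respects both saddle conditions. -/
theorem improve_isSubSaddle (hΩ : Convex ℝ Ω) (hH : IsSubSaddle Ω H) :
    IsSubSaddle Ω (improve Ω H) := by
  have hpos : (0 : ℝ) < n + 1 := by positivity
  refine ⟨subAntisymmetric_iff.2 fun x hx => ?_, fun y hy => ⟨hΩ, ?_⟩,
    fun x hx => ⟨convex_power hΩ n, ?_⟩⟩
  · simp only [improve, ← Finset.sum_div, Finset.sum_sub_distrib, ← Finset.mul_sum]
    refine div_nonpos_of_nonpos_of_nonneg ?_ hpos.le
    rw [← sum_others_rot, sub_nonpos]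
    exact Finset.sum_le_sum fun i _ => hH.others_le_envelope (rot_mem_power hx i)
  · intro x hx x' hx' a b ha hb hab
    have hx'' := hΩ hx hx' ha hb hab
    have h1 := (hH.concave y hy).2 hx hx' ha hb hab
    have h2 := realConcavification_le_combo (g := fun y => others H (Fin.cons (a • x + b • x') y))
      ha hb hy (fun z hz => others_smul_combo_le hH.convex hx hx' hz ha hb hab)
      (hH.bddAbove_hullValues hx y) (hH.bddAbove_hullValues hx' y)
    simp only [improve, envelope_cons, smul_eq_mul] at h1 ⊢
    rw [mul_div_assoc', mul_div_assoc', ← add_div]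
    have hn : (0 : ℝ) ≤ n := by positivity
    have h3 := mul_le_mul_of_nonneg_left h1 hn
    gcongr
    linarith
  · intro y hy y' hy' a b ha hb hab
    have h1 := (hH.convex x hx).2 hy hy' ha hb hab
    have h2 := (concaveOn_realConcavification (convex_power hΩ n)
      (fun y _ => hH.bddAbove_hullValues hx y)).2 hy hy' ha hb hab
    simp only [improve, envelope_cons, smul_eq_mul] at h1 h2 ⊢
    rw [mul_div_assoc', mul_div_assoc', ← add_div]
    have hn : (0 : ℝ) ≤ n := by positivity
    have h3 := mul_le_mul_of_nonneg_left h1 hn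
    gcongr
    linarith

theorem envelope_mono {K : (Fin (n + 1) → E d) → ℝ} (hK : IsSubSaddle Ω K)
    (hHK : ∀ x ∈ power Ω (n + 1), H x ≤ K x) {x : Fin (n + 1) → E d}
    (hx : x ∈ power Ω (n + 1)) : envelope Ω H x ≤ envelope Ω K x :=
  realConcavification_mono (tail_mem_power hx)
    (fun _ hz => Finset.sum_le_sum fun _ _ => hHK _ (rot_mem_power (cons_mem_power (hx 0) hz) _))
    (hK.bddAbove_hullValues (hx 0) _)

theorem of_tendsto (hΩ : Convex ℝ Ω) {Hk : ℕ → (Fin (n + 1) → E d) → ℝ}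
    (hk : ∀ k, IsSubSaddle Ω (Hk k))
    (hlim : ∀ x ∈ power Ω (n + 1), Tendsto (fun k => Hk k x) atTop (𝓝 (H x))) :
    IsSubSaddle Ω H := by
  refine ⟨subAntisymmetric_iff.2 fun x hx => ?_, fun y hy => ⟨hΩ, ?_⟩,
    fun x hx => ⟨convex_power hΩ n, ?_⟩⟩
  · exact le_of_tendsto' (tendsto_finsetSum _ fun i _ => hlim _ (rot_mem_power hx i))
      fun k => subAntisymmetric_iff.1 (hk k).sub x hx
  · intro x hx x' hx' a b ha hb hab
    exact le_of_tendsto_of_tendsto'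
      (((hlim _ (cons_mem_power hx hy)).const_smul a).add
        ((hlim _ (cons_mem_power hx' hy)).const_smul b))
      (hlim _ (cons_mem_power (hΩ hx hx' ha hb hab) hy))
      fun k => ((hk k).concave y hy).2 hx hx' ha hb hab
  · intro y hy y' hy' a b ha hb hab
    exact le_of_tendsto_of_tendsto'
      (hlim _ (cons_mem_power hx (convex_power hΩ n hy hy' ha hb hab)))
      (((hlim _ (cons_mem_power hx hy)).const_smul a).add
        ((hlim _ (cons_mem_power hx hy')).const_smul b))
      fun k => ((hk k).convex x hx).2 hy hy' ha hb hab

/-- Every sub-antisymmetric saddle function has a majorant of the same kind that is equal to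
`-H_{2,…,N}`. -/
theorem exists_ge_add_partialConcavification_eq_zero (hΩ : Convex ℝ Ω) (hH : IsSubSaddle Ω H) :
    ∃ K : (Fin (n + 1) → E d) → ℝ, IsSubSaddle Ω K ∧ (∀ x ∈ power Ω (n + 1), H x ≤ K x) ∧
      ∀ x ∈ power Ω (n + 1), (K x : EReal) + partialConcavification Ω K x = 0 := by
  set Hk : ℕ → (Fin (n + 1) → E d) → ℝ := fun k => (improve Ω)^[k] H with hHk
  have hsucc : ∀ k, Hk (k + 1) = improve Ω (Hk k) := fun k => Function.iterate_succ_apply' _ _ _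
  have hs : ∀ k, IsSubSaddle Ω (Hk k) := by
    intro k
    induction k with
    | zero => exact hH
    | succ k ih => rw [hsucc]; exact ih.improve_isSubSaddle hΩ
  have hmono : ∀ x ∈ power Ω (n + 1), Monotone fun k => Hk k x := fun x hx =>
    monotone_nat_of_le_succ fun k => by
      simp only [hsucc]
      exact (hs k).le_improve hx
  have hbdd : ∀ x ∈ power Ω (n + 1), BddAbove (Set.range fun k => Hk k x) := by
    intro x hx
    -- Each iterate satisfies `Hk ≤ -others Hk`, and `others Hk ≥ others H` because the iterates
    -- increase.
    refine ⟨-others H x, ?_⟩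
    rintro _ ⟨k, rfl⟩
    have h1 := others_le_neg (hs k).sub hx
    have h2 : others H x ≤ others (Hk k) x :=
      Finset.sum_le_sum fun i _ => hmono _ (rot_mem_power hx _) (Nat.zero_le k)
    simp only
    linarith
  have hlim : ∀ x ∈ power Ω (n + 1), Tendsto (fun k => Hk k x) atTop (𝓝 (⨆ k, Hk k x)) :=
    fun x hx => tendsto_atTop_ciSup (hmono x hx) (hbdd x hx)
  have hK := of_tendsto (H := fun x => ⨆ k, Hk k x) hΩ hs hlim
  refine ⟨_, hK, fun x hx => le_ciSup (hbdd x hx) 0, fun x hx => ?_⟩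
  have hle := hK.envelope_le_neg hx
  -- The recursion reads `(n + 1) (H_k - H_{k+1}) = H_k + envelope H_k ≤ H_k + envelope K`. In the
  -- limit the left side vanishes, leaving `0 ≤ K + envelope K`.
  have hge : (⨆ k, Hk k x) + (n + 1) * ((⨆ k, Hk k x) - ⨆ k, Hk k x) ≤
      (⨆ k, Hk k x) + ((⨆ k, Hk k x) + envelope Ω (fun x => ⨆ k, Hk k x) x) := by
    refine le_of_tendsto_of_tendsto' ((hlim x hx).add
      (((hlim x hx).sub ((hlim x hx).comp (tendsto_add_atTop_nat 1))).const_mul _))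
      ((hlim x hx).add ((hlim x hx).add_const _)) fun k => ?_
    have h1 := hK.envelope_mono (H := Hk k) (fun z hz => le_ciSup (hbdd z hz) k) hx
    have h2 : Hk (k + 1) x * (n + 1) = n * Hk k x - envelope Ω (Hk k) x := by
      rw [hsucc, improve, div_mul_cancel₀ _ (by positivity)]
    simp only [Function.comp_apply]
    nlinarith
  rw [hK.partialConcavification_eq hx, ← EReal.coe_add, ← EReal.coe_zero]
  congr 1
  linarith

end IsSubSaddle

end Saddle

end NMonotone

namespace NMonotone

/-! ### The saddle function generated by a jointly monotone family -/

section Generated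

variable {d n : ℕ} {Ω A : Set (E d)} {u : Fin n → E d → E d}

/-- The convex hull of the graph of `z ↦ (u z, ∑ ⟨u_ℓ z, z⟩)` over `A`. -/
def graphHull (A : Set (E d)) (u : Fin n → E d → E d) : Set (E d × (Fin n → E d) × ℝ) :=
  convexHull ℝ ((fun z => (z, (fun ℓ => u ℓ z), ∑ ℓ, inner ℝ (u ℓ z) z)) '' A)

/-- The values at `y` of the affine functions encoded by `graphHull`. -/
def affineValues (A : Set (E d)) (u : Fin n → E d → E d) (y : Fin n → E d) : Set (E d × ℝ) :=
  (fun g : E d × (Fin n → E d) × ℝ => (g.1, ∑ ℓ, inner ℝ (g.2.1 ℓ) (y ℓ) - g.2.2)) ''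
    graphHull A u

/-- The concavification in the first variable of `∑ ⟨u_ℓ x_1, x_{ℓ+1} - x_1⟩`. -/
noncomputable def generated (A : Set (E d)) (u : Fin n → E d → E d) (x : Fin (n + 1) → E d) : ℝ :=
  sSup {r | (x 0, r) ∈ affineValues A u (Fin.tail x)}

theorem convex_affineValues (y : Fin n → E d) : Convex ℝ (affineValues A u y) := by
  rintro _ ⟨g, hg, rfl⟩ _ ⟨g', hg', rfl⟩ a b ha hb hab
  refine ⟨a • g + b • g', convex_convexHull ℝ _ hg hg' ha hb hab, ?_⟩
  ext1
  · simp
  · simp only [Prod.snd_add, Prod.smul_snd, Prod.fst_add, Prod.smul_fst, Pi.add_apply,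
      Pi.smul_apply, inner_add_left, real_inner_smul_left, Finset.sum_add_distrib,
      ← Finset.mul_sum, smul_eq_mul]
    ring

/-- The bounds cut out a convex set containing the graph, hence containing its hull. -/
theorem graphHull_bound {C R : ℝ} (hC : ∀ ℓ, ∀ z ∈ A, ‖u ℓ z‖ ≤ C) (hR : ∀ z ∈ A, ‖z‖ ≤ R)
    {g : E d × (Fin n → E d) × ℝ} (hg : g ∈ graphHull A u) :
    (∀ ℓ, ‖g.2.1 ℓ‖ ≤ C) ∧ |g.2.2| ≤ n * (C * R) := by
  have hconv : Convex ℝ {g : E d × (Fin n → E d) × ℝ |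
      (∀ ℓ, ‖g.2.1 ℓ‖ ≤ C) ∧ |g.2.2| ≤ n * (C * R)} := by
    intro g hg g' hg' a b ha hb hab
    refine ⟨fun ℓ => ?_, ?_⟩
    · have := convex_closedBall (0 : E d) C (x := g.2.1 ℓ) (by simpa using hg.1 ℓ)
        (y := g'.2.1 ℓ) (by simpa using hg'.1 ℓ) ha hb hab
      simpa using this
    · have := convex_closedBall (0 : ℝ) (n * (C * R)) (x := g.2.2) (by simpa using hg.2)
        (y := g'.2.2) (by simpa using hg'.2) ha hb hab
      simpa using this
  refine convexHull_min ?_ hconv hg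
  rintro _ ⟨z, hz, rfl⟩
  refine ⟨fun ℓ => hC ℓ z hz, ?_⟩
  calc |∑ ℓ, inner ℝ (u ℓ z) z| ≤ ∑ ℓ, |inner ℝ (u ℓ z) z| := Finset.abs_sum_le_sum_abs _ _
    _ ≤ ∑ _ℓ : Fin n, C * R := Finset.sum_le_sum fun ℓ _ =>
        (abs_real_inner_le_norm _ _).trans (mul_le_mul (hC ℓ z hz) (hR z hz) (norm_nonneg _)
          ((norm_nonneg _).trans (hC ℓ z hz)))
    _ = n * (C * R) := by simp

theorem bddAbove_affineValues {C R : ℝ} (hC : ∀ ℓ, ∀ z ∈ A, ‖u ℓ z‖ ≤ C) (hR : ∀ z ∈ A, ‖z‖ ≤ R)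
    (x : E d) (y : Fin n → E d) : BddAbove {r | (x, r) ∈ affineValues A u y} := by
  refine ⟨∑ ℓ, C * ‖y ℓ‖ + n * (C * R), ?_⟩
  rintro r ⟨g, hg, hgr⟩
  obtain ⟨h1, h2⟩ := graphHull_bound hC hR hg
  have hr : ∑ ℓ, inner ℝ (g.2.1 ℓ) (y ℓ) - g.2.2 = r := congrArg Prod.snd hgr
  have h3 : ∑ ℓ, inner ℝ (g.2.1 ℓ) (y ℓ) ≤ ∑ ℓ, C * ‖y ℓ‖ := Finset.sum_le_sum fun ℓ _ =>
    (real_inner_le_norm _ _).trans (mul_le_mul_of_nonneg_right (h1 ℓ) (norm_nonneg _))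
  have := (abs_le.1 h2).1
  linarith

theorem affineValues_self {z : E d} (hz : z ∈ A) (y : Fin n → E d) :
    (z, ∑ ℓ, inner ℝ (u ℓ z) (y ℓ - z)) ∈ affineValues A u y := by
  refine ⟨_, subset_convexHull ℝ _ ⟨z, hz, rfl⟩, ?_⟩
  simp [inner_sub_right]

theorem affineValues_midpoint {x z : E d} (hz : z ∈ A) (hz' : (2 : ℝ) • x - z ∈ A)
    (y : Fin n → E d) :
    (x, (1 / 2 : ℝ) * ∑ ℓ, inner ℝ (u ℓ z) (y ℓ - z) +
      (1 / 2 : ℝ) * ∑ ℓ, inner ℝ (u ℓ ((2 : ℝ) • x - z)) (y ℓ - ((2 : ℝ) • x - z))) ∈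
      affineValues A u y := by
  have := convex_affineValues (A := A) (u := u) y (affineValues_self hz y)
    (affineValues_self hz' y) (a := 1 / 2) (b := 1 / 2) (by norm_num) (by norm_num) (by norm_num)
  convert this using 1
  ext1
  · simp [smul_sub, smul_smul]
  · simp

/-- Points of `Ω` are midpoints of arbitrarily close points of `A`. -/
def MidpointDense (Ω A : Set (E d)) : Prop :=
  ∀ x ∈ Ω, ∀ ε > 0, ∃ z ∈ A, dist z x < ε ∧ (2 : ℝ) • x - z ∈ A

/-- The cyclic sum of the affine functions encoded by `g`, which is affine in each `g i`. -/
noncomputable def cyclicSum (g : Fin (n + 1) → E d × (Fin n → E d) × ℝ) : ℝ :=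
  ∑ i, (∑ ℓ : Fin n, inner ℝ ((g i).2.1 ℓ) (g (i + ℓ.succ)).1 - (g i).2.2)

/-- Since `ℓ.succ ≠ 0`, the two entries `i` and `i + ℓ.succ` of an inner product are never the same
slot, so no term is quadratic in the updated one. -/
theorem cyclicSum_update (g : Fin (n + 1) → E d × (Fin n → E d) × ℝ) (k : Fin (n + 1))
    (v w : E d × (Fin n → E d) × ℝ) {a b : ℝ} (hab : a + b = 1) :
    cyclicSum (Function.update g k (a • v + b • w)) =
      a * cyclicSum (Function.update g k v) + b * cyclicSum (Function.update g k w) := by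
  have hone : ∀ t : ℝ, t = a * t + b * t := fun t => by rw [← add_mul, hab, one_mul]
  simp only [cyclicSum, Finset.mul_sum, mul_sub, ← Finset.sum_add_distrib]
  refine Finset.sum_congr rfl fun i _ => ?_
  have hS : ∑ ℓ : Fin n, inner ℝ ((Function.update g k (a • v + b • w) i).2.1 ℓ)
        (Function.update g k (a • v + b • w) (i + ℓ.succ)).1 =
      ∑ ℓ : Fin n, a * inner ℝ ((Function.update g k v i).2.1 ℓ)
        (Function.update g k v (i + ℓ.succ)).1 +
      ∑ ℓ : Fin n, b * inner ℝ ((Function.update g k w i).2.1 ℓ)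
        (Function.update g k w (i + ℓ.succ)).1 := by
    rw [← Finset.sum_add_distrib]
    refine Finset.sum_congr rfl fun ℓ _ => ?_
    by_cases hi : i = k
    · subst hi
      simp [inner_add_left, real_inner_smul_left]
    · by_cases hj : i + ℓ.succ = k
      · simp [hj, Function.update_of_ne hi, inner_add_right, real_inner_smul_right]
      · simp only [Function.update_of_ne hi, Function.update_of_ne hj]
        exact hone _
  have hT : (Function.update g k (a • v + b • w) i).2.2 =
      a * (Function.update g k v i).2.2 + b * (Function.update g k w i).2.2 := by
    by_cases hi : i = k
    · subst hi; simp
    · simp only [Function.update_of_ne hi]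
      exact hone _
  rw [hS, hT]
  ring

/-- On graph points this is joint monotonicity. Slots are then released one at a time from the graph
to its hull: in one slot the condition defines a convex set. -/
theorem cyclicSum_nonpos (hmono : JointlyMonotoneOn u A)
    {g : Fin (n + 1) → E d × (Fin n → E d) × ℝ} (hg : ∀ i, g i ∈ graphHull A u) :
    cyclicSum g ≤ 0 := by
  set Γ := (fun z => (z, (fun ℓ => u ℓ z), ∑ ℓ, inner ℝ (u ℓ z) z)) '' A with hΓ
  have key : ∀ s : Finset (Fin (n + 1)), ∀ g : Fin (n + 1) → E d × (Fin n → E d) × ℝ,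
      (∀ i ∈ s, g i ∈ graphHull A u) → (∀ i ∉ s, g i ∈ Γ) → cyclicSum g ≤ 0 := by
    intro s
    induction s using Finset.induction_on with
    | empty =>
      intro g _ hg
      choose z hz hzg using fun i => hg i (Finset.notMem_empty i)
      have h := hmono z hz
      have h2 : cyclicSum g =
          -∑ i, ∑ ℓ : Fin n, inner ℝ (u ℓ (z i)) (z i - z (i + ℓ.succ)) := by
        simp only [cyclicSum, ← hzg, inner_sub_right, Finset.sum_sub_distrib]
        ring
      linarith
    | insert k s hk ih =>
      intro g hg hg'
      have hc : Convex ℝ {v | cyclicSum (Function.update g k v) ≤ 0} := by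
        intro v hv w hw a b ha hb hab
        simp only [Set.mem_ofPred_eq] at hv hw ⊢
        rw [cyclicSum_update g k v w hab]
        exact add_nonpos (mul_nonpos_of_nonneg_of_nonpos ha hv)
          (mul_nonpos_of_nonneg_of_nonpos hb hw)
      have hsub : Γ ⊆ {v | cyclicSum (Function.update g k v) ≤ 0} := by
        intro v hv
        refine ih _ (fun i hi => ?_) fun i hi => ?_
        · have : i ≠ k := fun h => hk (h ▸ hi)
          rw [Function.update_of_ne this]
          exact hg i (Finset.mem_insert_of_mem hi)
        · by_cases h : i = k
          · subst h; simpa using hv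
          · rw [Function.update_of_ne h]
            exact hg' i (by simp [h, hi])
      have := convexHull_min hsub hc (hg k (Finset.mem_insert_self k s))
      simpa using this
  exact key Finset.univ g (fun i _ => hg i) (fun i hi => absurd (Finset.mem_univ i) hi)

theorem affineValues_nonempty (hA : MidpointDense Ω A) {x : E d} (hx : x ∈ Ω) (y : Fin n → E d) :
    {r | (x, r) ∈ affineValues A u y}.Nonempty := by
  obtain ⟨z, hz, -, hz'⟩ := hA x hx 1 one_pos
  exact ⟨_, affineValues_midpoint hz hz' y⟩

theorem generated_cons (x : E d) (y : Fin n → E d) :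
    generated A u (Fin.cons x y) = sSup {r | (x, r) ∈ affineValues A u y} := by
  simp [generated]

theorem generated_lipschitz {C R : ℝ} (hA : MidpointDense Ω A) (hC : ∀ ℓ, ∀ z ∈ A, ‖u ℓ z‖ ≤ C)
    (hR : ∀ z ∈ A, ‖z‖ ≤ R) {x : E d} (hx : x ∈ Ω) (y y' : Fin n → E d) :
    generated A u (Fin.cons x y) ≤ generated A u (Fin.cons x y') + n * |C| * ‖y - y'‖ := by
  rw [generated_cons, generated_cons]
  refine csSup_le (affineValues_nonempty hA hx y) ?_
  rintro r ⟨g, hg, hgr⟩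
  obtain ⟨h1, -⟩ := graphHull_bound hC hR hg
  have hgx : g.1 = x := congrArg Prod.fst hgr
  have hr : ∑ ℓ, inner ℝ (g.2.1 ℓ) (y ℓ) - g.2.2 = r := congrArg Prod.snd hgr
  have h2 : ∑ ℓ, inner ℝ (g.2.1 ℓ) (y' ℓ) - g.2.2 ≤ sSup {r | (x, r) ∈ affineValues A u y'} :=
    le_csSup (bddAbove_affineValues hC hR x y') ⟨g, hg, Prod.ext hgx rfl⟩
  have h3 : ∑ ℓ, inner ℝ (g.2.1 ℓ) (y ℓ) - ∑ ℓ, inner ℝ (g.2.1 ℓ) (y' ℓ) ≤ n * |C| * ‖y - y'‖ := by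
    rw [← Finset.sum_sub_distrib]
    calc ∑ ℓ, (inner ℝ (g.2.1 ℓ) (y ℓ) - inner ℝ (g.2.1 ℓ) (y' ℓ))
        ≤ ∑ _ℓ : Fin n, |C| * ‖y - y'‖ := Finset.sum_le_sum fun ℓ _ => by
          rw [← inner_sub_right]
          exact (real_inner_le_norm _ _).trans (mul_le_mul ((h1 ℓ).trans (le_abs_self C))
            (norm_le_pi_norm (y - y') ℓ) (norm_nonneg _) (abs_nonneg _))
      _ = n * |C| * ‖y - y'‖ := by simp [mul_assoc]
  linarith

theorem le_generated {C R : ℝ} (hC : ∀ ℓ, ∀ z ∈ A, ‖u ℓ z‖ ≤ C) (hR : ∀ z ∈ A, ‖z‖ ≤ R)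
    {z : E d} (hz : z ∈ A) (y : Fin n → E d) :
    ∑ ℓ, inner ℝ (u ℓ z) (y ℓ - z) ≤ generated A u (Fin.cons z y) := by
  rw [generated_cons]
  exact le_csSup (bddAbove_affineValues hC hR z y) (affineValues_self hz y)

/-- For `x ∈ A` this is immediate. Otherwise `x` is the midpoint of two points of `A` at distance
below any `δ`, and the corresponding average of `f` is at least `-n |C| δ`. -/
theorem generated_diag_nonneg {C R : ℝ} (hA : MidpointDense Ω A)
    (hC : ∀ ℓ, ∀ z ∈ A, ‖u ℓ z‖ ≤ C) (hR : ∀ z ∈ A, ‖z‖ ≤ R) {x : E d} (hx : x ∈ Ω) :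
    0 ≤ generated A u (fun _ => x) := by
  refine le_of_forall_pos_le_add fun ε hε => ?_
  have hpos : 0 < n * |C| + 1 := by positivity
  obtain ⟨z, hz, hd, hz'⟩ := hA x hx (ε / (n * |C| + 1)) (by positivity)
  rw [← cons_const x, generated_cons]
  have h1 := le_csSup (bddAbove_affineValues hC hR x (fun _ => x))
    (affineValues_midpoint (u := u) hz hz' (fun _ => x))
  have hb : ∀ w ∈ A, ‖x - w‖ = dist z x →
      -(n * |C| * dist z x) ≤ ∑ ℓ, inner ℝ (u ℓ w) (x - w) := by
    intro w hw hwd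
    have : ∑ _ℓ : Fin n, -(|C| * dist z x) ≤ ∑ ℓ, inner ℝ (u ℓ w) (x - w) :=
      Finset.sum_le_sum fun ℓ _ => by
        have h := (abs_le.1 (abs_real_inner_le_norm (u ℓ w) (x - w))).1
        have h' : ‖u ℓ w‖ * ‖x - w‖ ≤ |C| * dist z x := by
          rw [hwd]
          exact mul_le_mul_of_nonneg_right ((hC ℓ w hw).trans (le_abs_self C)) dist_nonneg
        linarith
    simpa [mul_assoc] using this
  have e1 := hb z hz (by rw [dist_comm, dist_eq_norm])
  have e2 := hb _ hz' (by rw [dist_eq_norm]; congr 1; rw [two_smul]; abel)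
  have e3 : n * |C| * dist z x ≤ ε := by
    rw [lt_div_iff₀ hpos] at hd
    nlinarith [dist_nonneg (x := z) (y := x)]
  linarith

theorem generated_isSubSaddle {C R : ℝ} (hΩ : Convex ℝ Ω) (hA : MidpointDense Ω A)
    (hC : ∀ ℓ, ∀ z ∈ A, ‖u ℓ z‖ ≤ C) (hR : ∀ z ∈ A, ‖z‖ ≤ R) (hmono : JointlyMonotoneOn u A) :
    IsSubSaddle Ω (generated A u) := by
  refine ⟨subAntisymmetric_iff.2 fun x hx => ?_, fun y _ => ?_,
    fun x hx => ⟨convex_power hΩ n, fun y _ y' _ a b ha hb hab => ?_⟩⟩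
  · refine le_of_forall_pos_le_add fun ε hε => ?_
    have hpos : (0 : ℝ) < n + 1 := by positivity
    -- Choose near-maximizers for the `N` rotations, each losing `ε / (n + 1)`; their total is a
    -- value of `cyclicSum`.
    have : ∀ i, ∃ g ∈ graphHull A u, g.1 = x i ∧ generated A u (rot i x) - ε / (n + 1) <
        ∑ ℓ : Fin n, inner ℝ (g.2.1 ℓ) (x (i + ℓ.succ)) - g.2.2 := by
      intro i
      obtain ⟨r, ⟨g, hg, hgr⟩, hr⟩ := exists_lt_of_lt_csSup
        (affineValues_nonempty (u := u) hA (rot_mem_power hx i 0) (Fin.tail (rot i x)))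
        (sub_lt_self _ (div_pos hε hpos))
      refine ⟨g, hg, by simpa using congrArg Prod.fst hgr, ?_⟩
      have h2 := congrArg Prod.snd hgr
      simp only [Fin.tail, rot_apply] at h2
      simp only [add_comm i, h2]
      exact hr
    choose g hg hgx hlt using this
    have h1 := cyclicSum_nonpos hmono hg
    simp only [cyclicSum, hgx] at h1
    have h2 := Finset.sum_le_sum fun i (_ : i ∈ Finset.univ) => (hlt i).le
    rw [Finset.sum_sub_distrib] at h2
    have h3 : ∑ _i : Fin (n + 1), ε / (n + 1) = ε := by
      simp only [Finset.sum_const, Finset.card_univ, Fintype.card_fin, nsmul_eq_mul]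
      push_cast
      field_simp
    linarith
  · simp only [generated_cons]
    exact concaveOn_sSup_of_convex hΩ (convex_affineValues y)
      (fun x hx => affineValues_nonempty hA hx y) (fun x _ => bddAbove_affineValues hC hR x y)
  · simp only [generated_cons]
    refine csSup_le (affineValues_nonempty hA hx _) ?_
    rintro r ⟨g, hg, hgr⟩
    have hgx : g.1 = x := congrArg Prod.fst hgr
    have hr := congrArg Prod.snd hgr
    have e1 := le_csSup (bddAbove_affineValues hC hR x y) ⟨g, hg, Prod.ext hgx rfl⟩
    have e2 := le_csSup (bddAbove_affineValues hC hR x y') ⟨g, hg, Prod.ext hgx rfl⟩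
    simp only [Pi.add_apply, Pi.smul_apply, inner_add_right, real_inner_smul_right,
      Finset.sum_add_distrib, ← Finset.mul_sum] at hr
    have h1 := mul_le_mul_of_nonneg_left e1 ha
    have h2 := mul_le_mul_of_nonneg_left e2 hb
    have h3 : g.2.2 = a * g.2.2 + b * g.2.2 := by rw [← add_mul, hab, one_mul]
    simp only [smul_eq_mul]
    linarith

theorem SubAntisymmetric.diag_nonpos {H : (Fin (n + 1) → E d) → ℝ} (hH : SubAntisymmetric Ω H)
    {x : E d} (hx : x ∈ Ω) : H (fun _ => x) ≤ 0 := by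
  have := subAntisymmetric_iff.1 hH (fun _ => x) fun _ => hx
  simp only [rot_const, Finset.sum_const, Finset.card_univ, Fintype.card_fin, nsmul_eq_mul] at this
  exact nonpos_of_mul_nonpos_right this (by positivity)

/-- A concave function on an open set is continuous, and the Lipschitz constant in `y` does not
depend on `x`; together these give joint continuity. -/
theorem continuousOn_generated {C R : ℝ} (hΩ : Convex ℝ Ω) (hΩo : IsOpen Ω)
    (hA : MidpointDense Ω A) (hC : ∀ ℓ, ∀ z ∈ A, ‖u ℓ z‖ ≤ C) (hR : ∀ z ∈ A, ‖z‖ ≤ R)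
    (hmono : JointlyMonotoneOn u A) : ContinuousOn (generated A u) (power Ω (n + 1)) := by
  have h : ContinuousOn (fun p : E d × (Fin n → E d) => generated A u (Fin.cons p.1 p.2))
      (Ω ×ˢ power Ω n) := by
    refine continuousOn_prod_of_continuousOn_lipschitzOnWith' _ (n * |C|).toNNReal
      (fun x hx => ?_) fun y hy => ?_
    · exact LipschitzOnWith.of_le_add_mul _ fun y _ y' _ => by
        rw [Real.coe_toNNReal _ (by positivity), dist_eq_norm]
        exact generated_lipschitz hA hC hR hx y y'
    · exact ((generated_isSubSaddle hΩ hA hC hR hmono).concave y hy).continuousOn hΩo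
  have hc : Continuous fun x : Fin (n + 1) → E d => (x 0, Fin.tail x) :=
    (continuous_apply 0).prodMk (continuous_pi fun i => continuous_apply _)
  have := h.comp hc.continuousOn (s := power Ω (n + 1)) fun x hx => ⟨hx 0, tail_mem_power hx⟩
  simpa [Function.comp_def] using this

end Generated

end NMonotone

namespace NMonotone

/-! ### Lebesgue points and the gradient on the diagonal -/

section Gradient

open Filter Topology Metric

variable {d n : ℕ} {Ω A : Set (E d)} {u : Fin n → E d → E d}

/-- Lebesgue differentiation holds along off-centre balls of bounded eccentricity. Applying it to
the filter `l` of all admissible pairs (centre, radius) makes the estimate uniform in the centre; `K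
> 1 / ε` ensures that `x` lies in the ball enlarged `K` times. -/
theorem ae_average_norm_sub_lt {F : Type*} [NormedAddCommGroup F] {U : E d → F}
    (hU : LocallyIntegrable U) :
    ∀ᵐ x, ∀ ε > 0, ∃ r₀ > 0, ∀ r, 0 < r → r < r₀ → ∀ y, dist y x ≤ r →
      ⨍ z in closedBall y (ε * r), ‖U z - U x‖ < ε := by
  have h : ∀ᵐ x, ∀ K : ℕ, ∀ {ι : Type} {l : Filter ι} (w : ι → E d) (δ : ι → ℝ)
      (_ : Tendsto δ l (𝓝[>] 0)) (_ : ∀ᶠ j in l, x ∈ closedBall (w j) (K * δ j)),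
      Tendsto (fun j => ⨍ y in closedBall (w j) (δ j), ‖U y - U x‖) l (𝓝 0) :=
    ae_all_iff.2 fun K =>
      (IsUnifLocDoublingMeasure.ae_tendsto_average_norm_sub volume hU K).mono
        fun x hx ι l w δ h1 h2 => hx w δ h1 h2
  filter_upwards [h] with x hx ε hε
  obtain ⟨K, hK⟩ := exists_nat_gt (1 / ε)
  set l : Filter (E d × ℝ) :=
    comap Prod.snd (𝓝[>] (0 : ℝ)) ⊓ 𝓟 {p | x ∈ closedBall p.1 (K * p.2)} with hl
  have h1 := hx K (l := l) Prod.fst Prod.snd (tendsto_comap.mono_left inf_le_left)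
    (mem_inf_of_right (mem_principal_self _))
  have h2 := h1.eventually (gt_mem_nhds hε)
  rw [hl, eventually_inf_principal, eventually_comap] at h2
  obtain ⟨δ₀, hδ₀, h3⟩ := mem_nhdsGT_iff_exists_Ioo_subset.1 h2
  have hδ₀' : (0 : ℝ) < δ₀ := hδ₀
  refine ⟨δ₀ / ε, by positivity, fun r hr hr' y hy => ?_⟩
  refine h3 (show ε * r ∈ Set.Ioo 0 δ₀ from ⟨by positivity, ?_⟩) (y, ε * r) rfl ?_
  · rw [lt_div_iff₀ hε] at hr'; linarith
  · simp only [Set.mem_ofPred_eq, mem_closedBall]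
    rw [dist_comm]
    refine hy.trans ?_
    rw [div_lt_iff₀ hε] at hK
    nlinarith

/-- The exceptional null set must not depend on the direction `v`. It is a countable union over the
integer bounds `K` on `‖v‖`. -/
theorem ae_tendsto_average_shift {F : Type*} [NormedAddCommGroup F] [NormedSpace ℝ F]
    [CompleteSpace F] {U : E d → F} (hU : LocallyIntegrable U) :
    ∀ᵐ x, ∀ v : E d, Tendsto (fun δ : ℝ => ⨍ z in closedBall (x + δ • v) δ, U z)
      (𝓝[>] 0) (𝓝 (U x)) := by
  have h : ∀ᵐ x, ∀ K : ℕ, ∀ {ι : Type} {l : Filter ι} (w : ι → E d) (δ : ι → ℝ)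
      (_ : Tendsto δ l (𝓝[>] 0)) (_ : ∀ᶠ j in l, x ∈ closedBall (w j) (K * δ j)),
      Tendsto (fun j => ⨍ y in closedBall (w j) (δ j), U y) l (𝓝 (U x)) :=
    ae_all_iff.2 fun K =>
      (IsUnifLocDoublingMeasure.ae_tendsto_average volume hU K).mono
        fun x hx ι l w δ h1 h2 => hx w δ h1 h2
  filter_upwards [h] with x hx v
  obtain ⟨K, hK⟩ := exists_nat_gt ‖v‖
  refine hx K (fun δ => x + δ • v) id tendsto_id ?_
  filter_upwards [self_mem_nhdsWithin] with δ hδ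
  have hδ' : (0 : ℝ) < δ := hδ
  rw [mem_closedBall, dist_eq_norm, sub_add_cancel_left, norm_neg, norm_smul, Real.norm_eq_abs,
    abs_of_pos hδ', mul_comm]
  exact mul_le_mul_of_nonneg_right hK.le hδ'.le

theorem integrable_indicator_field (hΩo : IsOpen Ω) (hΩb : Bornology.IsBounded Ω)
    (hu_meas : ∀ ℓ, AEMeasurable (u ℓ) (volume.restrict Ω))
    (hu_bdd : ∀ ℓ, ∃ C : ℝ, ∀ x ∈ Ω, ‖u ℓ x‖ ≤ C) (ℓ : Fin n) :
    Integrable (Ω.indicator (u ℓ)) := by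
  rw [integrable_indicator_iff hΩo.measurableSet]
  obtain ⟨C, hC⟩ := hu_bdd ℓ
  have : IsFiniteMeasure (volume.restrict Ω) := ⟨by simpa using hΩb.measure_lt_top⟩
  exact Integrable.of_bound (hu_meas ℓ).aestronglyMeasurable C
    ((ae_restrict_iff' hΩo.measurableSet).2 (ae_of_all _ hC))

/-- Near `x`, every ball contains comparably close points of `A` at which `u` is close to `u x`. -/
def ApproxContinuous (u : Fin n → E d → E d) (A : Set (E d)) (x : E d) : Prop :=
  ∀ ε > 0, ∃ r₀ > 0, ∀ r, 0 < r → r < r₀ → ∀ y, dist y x ≤ r →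
    ∃ z ∈ A, dist z y ≤ ε * r ∧ ∀ ℓ, ‖u ℓ z - u ℓ x‖ ≤ ε

theorem ae_approxContinuous (hΩo : IsOpen Ω) (hΩb : Bornology.IsBounded Ω)
    (hu_meas : ∀ ℓ, AEMeasurable (u ℓ) (volume.restrict Ω))
    (hu_bdd : ∀ ℓ, ∃ C : ℝ, ∀ x ∈ Ω, ‖u ℓ x‖ ≤ C) {Ω₀ : Set (E d)} (h0 : volume Ω₀ = 0) :
    ∀ᵐ x, x ∈ Ω → ApproxContinuous u (Ω \ Ω₀) x := by
  have hU : Integrable (fun x => fun ℓ => Ω.indicator (u ℓ) x) :=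
    Integrable.of_eval fun ℓ => integrable_indicator_field hΩo hΩb hu_meas hu_bdd ℓ
  filter_upwards [ae_average_norm_sub_lt hU.locallyIntegrable] with x hx hxΩ ε hε
  obtain ⟨r₀, hr₀, h⟩ := hx ε hε
  obtain ⟨ρ, hρ, hball⟩ := Metric.isOpen_iff.1 hΩo x hxΩ
  -- A point within `ε * r` of `y` is within `(1 + ε) * r` of `x`, so this bound keeps it inside
  -- `Ω`.
  refine ⟨min r₀ (ρ / (1 + ε)), by positivity, fun r hr hr' y hy => ?_⟩
  have h1 := h r hr (hr'.trans_le (min_le_left _ _)) y hy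
  have h2 := hr'.trans_le (min_le_right _ _)
  have hne : volume.restrict (closedBall y (ε * r)) ≠ 0 := by
    rw [Ne, Measure.restrict_eq_zero]
    exact (measure_closedBall_pos volume y (by positivity)).ne'
  have : IsFiniteMeasure (volume.restrict (closedBall y (ε * r))) :=
    ⟨by simpa using measure_closedBall_lt_top⟩
  -- The complement of the ball is null for the restricted measure; including it forces the selected
  -- `z` into the ball.
  have hN : (volume.restrict (closedBall y (ε * r))) (Ω₀ ∪ (closedBall y (ε * r))ᶜ) = 0 := by
    refine measure_union_null ?_ ?_
    · exact Measure.absolutelyContinuous_of_le Measure.restrict_le_self h0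
    · rw [Measure.restrict_apply measurableSet_closedBall.compl]; simp
  obtain ⟨z, hz, hzle⟩ := exists_notMem_null_le_average hne
    ((hU.restrict.sub (integrable_const (fun ℓ => Ω.indicator (u ℓ) x))).norm) hN
  simp only [Set.mem_union, Set.mem_compl_iff, not_or, not_not] at hz
  have hzΩ : z ∈ Ω := hball <| by
    rw [mem_ball]
    rw [lt_div_iff₀ (by positivity)] at h2
    have := dist_triangle z y x
    have := mem_closedBall.1 hz.2
    linarith
  refine ⟨z, ⟨hzΩ, hz.1⟩, hz.2, fun ℓ => ?_⟩
  have := (norm_le_pi_norm _ ℓ).trans (hzle.trans h1.le)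
  simpa [hzΩ, hxΩ] using this

theorem midpointDense_diff_null (hΩo : IsOpen Ω) {Ω₀ : Set (E d)} (h0 : volume Ω₀ = 0) :
    MidpointDense Ω (Ω \ Ω₀) := by
  intro x hx ε hε
  obtain ⟨ρ, hρ, hball⟩ := Metric.isOpen_iff.1 hΩo x hx
  -- Reflection through `x` preserves volume, so both `z` and its mirror image can avoid `Ω₀`.
  have hN : volume (Ω₀ ∪ (fun z => (2 : ℝ) • x - z) ⁻¹' Ω₀) = 0 :=
    measure_union_null h0
      ((Measure.measurePreserving_sub_left volume
        ((2 : ℝ) • x)).quasiMeasurePreserving.preimage_null h0)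
  have hpos : 0 < volume (ball x (min ε ρ)) := measure_ball_pos _ _ (by positivity)
  rw [← measure_sdiff_null hN] at hpos
  obtain ⟨z, hz, hzN⟩ := nonempty_of_measure_ne_zero hpos.ne'
  simp only [Set.mem_union, Set.mem_preimage, not_or] at hzN
  have hz1 : dist z x < ε := (mem_ball.1 hz).trans_le (min_le_left _ _)
  have hz2 : dist z x < ρ := (mem_ball.1 hz).trans_le (min_le_right _ _)
  refine ⟨z, ⟨hball hz2, hzN.1⟩, hz1, hball ?_, hzN.2⟩
  rw [mem_ball, dist_eq_norm]
  rw [dist_comm, dist_eq_norm] at hz2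
  convert hz2 using 2
  rw [two_smul]; abel

theorem sum_rot_tail_sub (t : Fin (n + 1) → E d) (ℓ : Fin n) :
    ∑ m : Fin n, (t (m.succ + ℓ.succ) - t m.succ) = -(t ℓ.succ - t 0) := by
  have h : ∑ i : Fin (n + 1), (t (i + ℓ.succ) - t i) = 0 := by
    rw [Finset.sum_sub_distrib, sub_eq_zero]
    exact Fintype.sum_equiv (Equiv.addRight ℓ.succ) _ _ fun _ => rfl
  rw [Fin.sum_univ_succ, zero_add] at h
  rw [eq_neg_iff_add_eq_zero, add_comm]
  exact h

/-- An upper bound for a sub-antisymmetric function in terms of affine minorants. -/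
theorem le_of_subAntisymmetric_of_minorant {H : (Fin (n + 1) → E d) → ℝ}
    (hH : SubAntisymmetric Ω H) (hAΩ : A ⊆ Ω)
    (hlow : ∀ z ∈ A, ∀ y ∈ power Ω n, ∑ ℓ, inner ℝ (u ℓ z) (y ℓ - z) ≤ H (Fin.cons z y))
    {t : Fin (n + 1) → E d} (ht : ∀ i, t i ∈ A) {ε s : ℝ} (hε : 0 ≤ ε)
    (hu : ∀ m ℓ, ‖u ℓ (t m) - u ℓ (t 0)‖ ≤ ε) (hs : ∀ i, ‖t i - t 0‖ ≤ s) :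
    H t ≤ ∑ ℓ : Fin n, inner ℝ (u ℓ (t 0)) (t ℓ.succ - t 0) + n * (n * (ε * (2 * s))) := by
  have htΩ : t ∈ power Ω (n + 1) := fun i => hAΩ (ht i)
  have h1 := IsSubSaddle.others_le_neg hH htΩ
  have h2 : ∑ m : Fin n, ∑ ℓ : Fin n, inner ℝ (u ℓ (t m.succ)) (t (m.succ + ℓ.succ) - t m.succ) ≤
      others H t := by
    refine Finset.sum_le_sum fun m _ => ?_
    have := hlow (t m.succ) (ht _) _ (tail_mem_power (rot_mem_power htΩ m.succ))
    have hc : (Fin.cons (t m.succ) (Fin.tail (rot m.succ t)) : Fin (n + 1) → E d) =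
        rot m.succ t := by
      conv_rhs => rw [← Fin.cons_self_tail (rot m.succ t)]
      simp
    rw [hc] at this
    simpa [Fin.tail, add_comm m.succ] using this
  -- With the fields frozen at `t 0`, the full cyclic sum vanishes, so the nontrivial rotations sum
  -- to minus the trivial one. The next estimate is the cost of freezing.
  have h3 : ∑ m : Fin n, ∑ ℓ : Fin n,
      inner ℝ (u ℓ (t 0)) (t (m.succ + ℓ.succ) - t m.succ) =
      -∑ ℓ : Fin n, inner ℝ (u ℓ (t 0)) (t ℓ.succ - t 0) := by
    rw [Finset.sum_comm, ← Finset.sum_neg_distrib]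
    refine Finset.sum_congr rfl fun ℓ _ => ?_
    rw [← inner_sum, sum_rot_tail_sub, inner_neg_right]
  have h4 : ∑ m : Fin n, ∑ ℓ : Fin n,
      (inner ℝ (u ℓ (t 0)) (t (m.succ + ℓ.succ) - t m.succ) -
        inner ℝ (u ℓ (t m.succ)) (t (m.succ + ℓ.succ) - t m.succ)) ≤
      ∑ _m : Fin n, ∑ _ℓ : Fin n, ε * (2 * s) := by
    refine Finset.sum_le_sum fun m _ => Finset.sum_le_sum fun ℓ _ => ?_
    rw [← inner_sub_left]
    refine (real_inner_le_norm _ _).trans (mul_le_mul ?_ ?_ (norm_nonneg _) hε)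
    · rw [norm_sub_rev]; exact hu _ _
    · have := norm_sub_le_norm_sub_add_norm_sub (t (m.succ + ℓ.succ)) (t 0) (t m.succ)
      rw [norm_sub_rev (t 0)] at this
      linarith [hs (m.succ + ℓ.succ), hs m.succ]
  simp only [Finset.sum_sub_distrib, h3] at h4
  simp only [Finset.sum_const, Finset.card_univ, Fintype.card_fin, nsmul_eq_mul] at h4
  linarith

/-- The minorant at `x` gives the lower bound for every `y`. For the upper bound, `y` is replaced by
a nearby `z` with entries in `A` where `u` is close to `u x`; sub-antisymmetry applies at `(x, z)`,
and the local Lipschitz property of a convex function leads back to `y`. -/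
theorem IsSubSaddle.hasDiagonalGradient {H : (Fin (n + 1) → E d) → ℝ} (hH : IsSubSaddle Ω H)
    (hΩo : IsOpen Ω) (hAΩ : A ⊆ Ω)
    (hlow : ∀ z ∈ A, ∀ y ∈ power Ω n, ∑ ℓ, inner ℝ (u ℓ z) (y ℓ - z) ≤ H (Fin.cons z y))
    {x : E d} (hx : x ∈ A) (hcont : ApproxContinuous u A x) :
    HasDiagonalGradient H (fun ℓ => u ℓ x) x := by
  have hxΩ := hAΩ hx
  set h : (Fin n → E d) → ℝ := fun y => H (Fin.cons x y) with hh
  set D : Fin n → E d := fun _ => x with hD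
  have hDΩ : D ∈ power Ω n := fun _ => hxΩ
  have hD0 : h D = 0 := by
    refine le_antisymm ?_ ?_
    · rw [hh, hD]; simp only [cons_const]; exact SubAntisymmetric.diag_nonpos hH.sub hxΩ
    · simpa [hD] using hlow x hx D hDΩ
  obtain ⟨K, t, ht, hK⟩ := (hH.convex x hxΩ).locallyLipschitzOn (isOpen_power hΩo n) hDΩ
  rw [(isOpen_power hΩo n).nhdsWithin_eq hDΩ] at ht
  obtain ⟨ρ, hρ, hball⟩ := Metric.mem_nhds_iff.1
    (inter_mem ht ((isOpen_power hΩo n).mem_nhds hDΩ))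
  unfold HasDiagonalGradient
  rw [hasFDerivAt_iff_isLittleO, Asymptotics.isLittleO_iff]
  intro c hc
  set S : ℝ := ∑ ℓ, ‖u ℓ x‖ with hS
  have hS0 : 0 ≤ S := Finset.sum_nonneg fun _ _ => norm_nonneg _
  -- `K` and `S` pay for moving `H` and the linear form from `z` to `y`, and `4 n²` for freezing the
  -- fields with `s = 2 * r`. The `1` makes `M` positive.
  set M : ℝ := K + S + n * (n * 4) + 1 with hM
  have hM0 : 0 < M := by positivity
  set ε := min 1 (c / M) with hε_def
  have hε : 0 < ε := by positivity
  have hε1 : ε ≤ 1 := min_le_left _ _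
  have hεM : ε * M ≤ c := by
    have : ε ≤ c / M := min_le_right _ _
    rwa [le_div_iff₀ hM0] at this
  obtain ⟨r₀, hr₀, hr⟩ := hcont ε hε
  filter_upwards [ball_mem_nhds D (show 0 < min r₀ (ρ / 2) by positivity)] with y hy
  set r := ‖y - D‖ with hr_def
  rw [mem_ball, dist_eq_norm] at hy
  have hyr₀ : r < r₀ := hy.trans_le (min_le_left _ _)
  have hyρ : r < ρ / 2 := hy.trans_le (min_le_right _ _)
  rcases (norm_nonneg (y - D)).eq_or_lt with h0 | hpos
  · have : y = D := by rwa [eq_comm, norm_eq_zero, sub_eq_zero] at h0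
    subst this
    simp [hr_def, hD]
  have hcomp : ∀ ℓ, ‖y ℓ - x‖ ≤ r := fun ℓ => norm_le_pi_norm (y - D) ℓ
  choose z hzA hzy hzu using fun ℓ => hr r hpos hyr₀ (y ℓ) (by rw [dist_eq_norm]; exact hcomp ℓ)
  have hεr : ε * r ≤ r := by nlinarith
  have hzy' : ‖y - z‖ ≤ ε * r := by
    rw [pi_norm_le_iff_of_nonneg (by positivity)]
    intro ℓ
    rw [Pi.sub_apply, ← dist_eq_norm, dist_comm]
    exact hzy ℓ
  have hzx : ∀ ℓ, ‖z ℓ - x‖ ≤ 2 * r := fun ℓ => by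
    have := norm_sub_le_norm_sub_add_norm_sub (z ℓ) (y ℓ) x
    have h2 := hzy ℓ
    rw [dist_eq_norm] at h2
    linarith [hcomp ℓ]
  have hy_mem : y ∈ t ∩ power Ω n := hball (by rw [mem_ball, dist_eq_norm]; linarith)
  have hz_mem : z ∈ t ∩ power Ω n := hball (by
    rw [mem_ball, dist_eq_norm]
    refine lt_of_le_of_lt ?_ (show 2 * r < ρ by linarith)
    rw [pi_norm_le_iff_of_nonneg (by positivity)]
    exact hzx)
  have hlowy : ∑ ℓ, inner ℝ (u ℓ x) (y ℓ - x) ≤ h y := hlow x hx y hy_mem.2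
  have hlip : h y ≤ h z + K * (ε * r) := by
    have := hK.dist_le_mul y hy_mem.1 z hz_mem.1
    rw [Real.dist_eq, dist_eq_norm] at this
    have h2 := (abs_le.1 this).2
    have h3 : (K : ℝ) * ‖y - z‖ ≤ K * (ε * r) := by gcongr
    linarith
  have hup : h z ≤ ∑ ℓ, inner ℝ (u ℓ x) (z ℓ - x) + n * (n * (ε * (2 * (2 * r)))) := by
    have := le_of_subAntisymmetric_of_minorant hH.sub hAΩ hlow
      (t := (Fin.cons x z : Fin (n + 1) → E d)) (ε := ε) (s := 2 * r)
      (Fin.cases (by simpa using hx) (by simpa using hzA)) hε.le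
      (Fin.cases (by simp [hε.le]) (by simpa using hzu))
      (Fin.cases (by simp; positivity) (by simpa using hzx))
    simpa using this
  have hlin : ∑ ℓ, inner ℝ (u ℓ x) (z ℓ - x) ≤ ∑ ℓ, inner ℝ (u ℓ x) (y ℓ - x) + S * (ε * r) := by
    rw [hS, Finset.sum_mul, ← Finset.sum_add_distrib]
    refine Finset.sum_le_sum fun ℓ _ => ?_
    have h2 : inner ℝ (u ℓ x) (z ℓ - y ℓ) ≤ ‖u ℓ x‖ * (ε * r) :=
      (real_inner_le_norm _ _).trans (mul_le_mul_of_nonneg_left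
        (by rw [← dist_eq_norm]; exact hzy ℓ) (norm_nonneg _))
    have h3 : z ℓ - x = (y ℓ - x) + (z ℓ - y ℓ) := by abel
    rw [h3, inner_add_right]
    linarith
  have hL : (∑ ℓ : Fin n, (innerSL ℝ (u ℓ x)).comp (ContinuousLinearMap.proj (R := ℝ) ℓ))
      (y - D) = ∑ ℓ, inner ℝ (u ℓ x) (y ℓ - x) := by
    simp [hD]
  change ‖h y - h D - _‖ ≤ c * r
  rw [hL, hD0, Real.norm_eq_abs, abs_le]
  have hfin : ε * M * r ≤ c * r := by gcongr
  have hexp : ε * M * r = K * (ε * r) + S * (ε * r) + n * (n * (ε * (2 * (2 * r)))) + ε * r := by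
    rw [hM]; ring
  have : 0 < ε * r := by positivity
  have : 0 ≤ c * r := by positivity
  constructor <;> linarith

end Gradient

end NMonotone

namespace NMonotone

/-! ### Symmetric plans and cyclic measure-preserving maps -/

section Plans

variable {d n : ℕ} {Ω : Set (E d)} {u : Fin n → E d → E d} {μ : Measure (E d)}

theorem measurable_cyc : Measurable (cyc : (Fin (n + 1) → E d) → _) :=
  measurable_pi_lambda _ fun _ => measurable_pi_apply _

theorem measurable_rot (i : Fin (n + 1)) : Measurable (rot i : (Fin (n + 1) → E d) → _) :=
  measurable_pi_lambda _ fun _ => measurable_pi_apply _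

theorem measurePreserving_rot {π : Measure (Fin (n + 1) → E d)} (hπ : π ∈ symmetricPlans n Ω μ)
    (i : Fin (n + 1)) : MeasurePreserving (rot i) π π := by
  have h : MeasurePreserving cyc π π := ⟨measurable_cyc, hπ.2.2.1⟩
  have h2 := h.iterate i
  have h3 : (cyc^[(i : ℕ)] : (Fin (n + 1) → E d) → _) = rot i := funext fun x => cyc_iterate_val i x
  rwa [h3] at h2

/-- The integrand of `planCost`. -/
noncomputable def planIntegrand (u : Fin n → E d → E d) (x : Fin (n + 1) → E d) : ℝ :=
  ∑ ℓ : Fin n, inner ℝ (u ℓ (x 0)) (x 0 - x ℓ.succ)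

theorem aestronglyMeasurable_planIntegrand (hu : ∀ ℓ, AEMeasurable (u ℓ) μ)
    {π : Measure (Fin (n + 1) → E d)} (hπ : π ∈ symmetricPlans n Ω μ) :
    AEStronglyMeasurable (planIntegrand u) π := by
  refine AEMeasurable.aestronglyMeasurable ?_
  refine Finset.aemeasurable_fun_sum _ fun ℓ _ => ?_
  have h0 : Measurable fun x : Fin (n + 1) → E d => x 0 := measurable_pi_apply 0
  have h1 : AEMeasurable (fun x : Fin (n + 1) → E d => u ℓ (x 0)) π := by
    have := hu ℓ
    rw [← hπ.2.2.2] at this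
    exact this.comp_measurable h0
  exact h1.inner (h0.sub (measurable_pi_apply _)).aemeasurable

theorem integrable_planIntegrand (hΩb : Bornology.IsBounded Ω)
    (hu : ∀ ℓ, AEMeasurable (u ℓ) μ) (hu_bdd : ∀ ℓ, ∃ C : ℝ, ∀ x ∈ Ω, ‖u ℓ x‖ ≤ C)
    {π : Measure (Fin (n + 1) → E d)} (hπ : π ∈ symmetricPlans n Ω μ) :
    Integrable (planIntegrand u) π := by
  have := hπ.1
  choose C hC using hu_bdd
  obtain ⟨R, hR⟩ := hΩb.exists_norm_le
  refine Integrable.of_bound (aestronglyMeasurable_planIntegrand hu hπ)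
    (∑ ℓ, C ℓ * (R + R)) ?_
  filter_upwards [hπ.2.1] with x hx
  refine (norm_sum_le _ _).trans (Finset.sum_le_sum fun ℓ _ => ?_)
  refine (norm_inner_le_norm _ _).trans (mul_le_mul (hC ℓ _ (hx 0)) ?_ (norm_nonneg _)
    ((norm_nonneg _).trans (hC ℓ _ (hx 0))))
  exact (norm_sub_le _ _).trans (add_le_add (hR _ (hx _)) (hR _ (hx _)))

theorem planCost_nonneg (hΩb : Bornology.IsBounded Ω) (hu : ∀ ℓ, AEMeasurable (u ℓ) μ)
    (hu_bdd : ∀ ℓ, ∃ C : ℝ, ∀ x ∈ Ω, ‖u ℓ x‖ ≤ C) {A : Set (E d)} (hA : ∀ᵐ x ∂μ, x ∈ A)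
    (hmono : JointlyMonotoneOn u A) {π : Measure (Fin (n + 1) → E d)}
    (hπ : π ∈ symmetricPlans n Ω μ) : 0 ≤ planCost u π := by
  have hint := integrable_planIntegrand hΩb hu hu_bdd hπ
  have hi : ∀ i, ∫ x, planIntegrand u (rot i x) ∂π = planCost u π := by
    intro i
    have hp := measurePreserving_rot hπ i
    have h1 := integral_map (μ := π) (measurable_rot i).aemeasurable (f := planIntegrand u)
      (by rw [hp.map_eq]; exact hint.aestronglyMeasurable)
    rw [hp.map_eq] at h1
    exact h1.symm
  have hsum : ∫ x, ∑ i, planIntegrand u (rot i x) ∂π = (n + 1) * planCost u π := by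
    have hin : ∀ i, Integrable (fun x => planIntegrand u (rot i x)) π := fun i =>
      (measurePreserving_rot hπ i).integrable_comp_of_integrable hint
    rw [integral_finsetSum _ fun i _ => hin i]
    simp [hi]
  have h0 : ∀ᵐ x ∂π, x 0 ∈ A := by
    rw [← hπ.2.2.2] at hA
    exact ae_of_ae_map (measurable_pi_apply 0).aemeasurable hA
  have hall : ∀ᵐ x ∂π, ∀ i, x i ∈ A := by
    refine ae_all_iff.2 fun i => ?_
    have := (measurePreserving_rot hπ i).quasiMeasurePreserving.ae h0
    simpa using this
  have hnn : 0 ≤ ∫ x, ∑ i, planIntegrand u (rot i x) ∂π := by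
    refine integral_nonneg_of_ae (hall.mono fun x hx => ?_)
    simpa [planIntegrand, add_comm] using hmono x hx
  rw [hsum] at hnn
  exact nonneg_of_mul_nonneg_right hnn (by positivity)

theorem diag_mem_symmetricPlans [IsProbabilityMeasure μ] (hΩo : IsOpen Ω)
    (hμ : ∀ᵐ x ∂μ, x ∈ Ω) : μ.map (fun x => fun _ : Fin (n + 1) => x) ∈ symmetricPlans n Ω μ := by
  have hd : Measurable (fun x : E d => fun _ : Fin (n + 1) => x) :=
    measurable_pi_lambda _ fun _ => measurable_id
  refine ⟨Measure.isProbabilityMeasure_map hd.aemeasurable, ?_, ?_, ?_⟩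
  · exact (ae_map_iff hd.aemeasurable (isOpen_power hΩo _).measurableSet).2
      (hμ.mono fun x hx _ => hx)
  · rw [Measure.map_map measurable_cyc hd]; rfl
  · rw [Measure.map_map (measurable_pi_apply 0) hd]
    exact Measure.map_id

theorem planCost_diag [IsProbabilityMeasure μ] (hΩo : IsOpen Ω) (hμ : ∀ᵐ x ∂μ, x ∈ Ω)
    (hu : ∀ ℓ, AEMeasurable (u ℓ) μ) :
    planCost u (μ.map (fun x => fun _ : Fin (n + 1) => x)) = 0 := by
  have hd : Measurable (fun x : E d => fun _ : Fin (n + 1) => x) :=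
    measurable_pi_lambda _ fun _ => measurable_id
  have := integral_map hd.aemeasurable
    (aestronglyMeasurable_planIntegrand hu (diag_mem_symmetricPlans hΩo hμ))
  unfold planCost
  exact this.trans (by simp [planIntegrand])

/-- The orbit `(x, S x, …, S^{N-1} x)`. -/
def orbit (n : ℕ) (S : E d → E d) (x : E d) : Fin (n + 1) → E d := fun i => S^[(i : ℕ)] x

theorem measurable_orbit {S : E d → E d} (hS : Measurable S) : Measurable (orbit n S) :=
  measurable_pi_lambda _ fun _ => hS.iterate _

theorem map_orbit_mem_symmetricPlans [IsProbabilityMeasure μ] (hΩo : IsOpen Ω)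
    (hμ : ∀ᵐ x ∂μ, x ∈ Ω) {S : E d → E d} (hS : S ∈ involutions n Ω μ) :
    μ.map (orbit n S) ∈ symmetricPlans n Ω μ := by
  obtain ⟨hmaps, hpres, hper⟩ := hS
  have hT := measurable_orbit (n := n) hpres.measurable
  refine ⟨Measure.isProbabilityMeasure_map hT.aemeasurable, ?_, ?_, ?_⟩
  · exact (ae_map_iff hT.aemeasurable (isOpen_power hΩo _).measurableSet).2
      (hμ.mono fun x hx i => hmaps.iterate i hx)
  · rw [Measure.map_map measurable_cyc hT]
    -- Only the last coordinate needs `S^N = I`; on the others, shifting the orbit is the same as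
    -- starting at `S x`.
    have : cyc ∘ orbit n S =ᵐ[μ] orbit n S ∘ S := by
      filter_upwards [hper] with x hx
      ext1 i
      simp only [Function.comp_apply, cyc, orbit]
      refine Fin.lastCases ?_ (fun j => ?_) i
      · simp only [Fin.last_add_one, Fin.val_zero, Function.iterate_zero, id, Fin.val_last]
        rw [← Function.iterate_succ_apply, hx]
      · rw [Fin.coeSucc_eq_succ, Fin.val_succ, Fin.val_castSucc, Function.iterate_succ_apply]
    rw [Measure.map_congr this, ← Measure.map_map hT hpres.measurable, hpres.map_eq]
  · rw [Measure.map_map (measurable_pi_apply 0) hT]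
    exact Measure.map_id

theorem planCost_map_orbit [IsProbabilityMeasure μ] (hΩo : IsOpen Ω)
    (hμ : ∀ᵐ x ∂μ, x ∈ Ω) (hu : ∀ ℓ, AEMeasurable (u ℓ) μ) {S : E d → E d}
    (hS : S ∈ involutions n Ω μ) : planCost u (μ.map (orbit n S)) =
      ∫ x, ∑ ℓ : Fin n, inner ℝ (u ℓ x) (x - S^[(ℓ : ℕ) + 1] x) ∂μ := by
  have := integral_map (measurable_orbit (n := n) hS.2.1.measurable).aemeasurable
    (aestronglyMeasurable_planIntegrand hu (map_orbit_mem_symmetricPlans hΩo hμ hS))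
  exact this.trans (by simp [planIntegrand, orbit])

theorem id_mem_involutions : id ∈ involutions n Ω μ :=
  ⟨Set.mapsTo_id _, MeasurePreserving.id _, by simp⟩

theorem integrable_inner_field [IsProbabilityMeasure μ] (hμ : ∀ᵐ x ∂μ, x ∈ Ω)
    (hu : ∀ ℓ, AEMeasurable (u ℓ) μ) (hu_bdd : ∀ ℓ, ∃ C : ℝ, ∀ x ∈ Ω, ‖u ℓ x‖ ≤ C)
    (hΩb : Bornology.IsBounded Ω) (ℓ : Fin n) {f : E d → E d} (hf : Measurable f)
    (hfΩ : Set.MapsTo f Ω Ω) : Integrable (fun x => inner ℝ (u ℓ x) (f x)) μ := by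
  obtain ⟨C, hC⟩ := hu_bdd ℓ
  obtain ⟨R, hR⟩ := hΩb.exists_norm_le
  refine Integrable.of_bound ((hu ℓ).inner hf.aemeasurable).aestronglyMeasurable (C * R) ?_
  filter_upwards [hμ] with x hx
  exact (norm_inner_le_norm _ _).trans (mul_le_mul (hC _ hx) (hR _ (hfΩ hx)) (norm_nonneg _)
    ((norm_nonneg _).trans (hC _ hx)))

theorem integrable_sq_of_bdd [IsProbabilityMeasure μ] (hμ : ∀ᵐ x ∂μ, x ∈ Ω) {f : E d → E d}
    (hf : AEMeasurable f μ) {C : ℝ} (hC : ∀ x ∈ Ω, ‖f x‖ ≤ C) :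
    Integrable (fun x => ‖f x‖ ^ 2) μ := by
  refine Integrable.of_bound (hf.norm.pow_const 2).aestronglyMeasurable (C ^ 2) ?_
  filter_upwards [hμ] with x hx
  rw [Real.norm_of_nonneg (by positivity)]
  exact pow_le_pow_left₀ (norm_nonneg _) (hC x hx) 2

theorem integral_inner_sub_eq [IsProbabilityMeasure μ] (hμ : ∀ᵐ x ∂μ, x ∈ Ω)
    (hu : ∀ ℓ, AEMeasurable (u ℓ) μ) (hu_bdd : ∀ ℓ, ∃ C : ℝ, ∀ x ∈ Ω, ‖u ℓ x‖ ≤ C)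
    (hΩb : Bornology.IsBounded Ω) {S : E d → E d} (hS : S ∈ involutions n Ω μ) :
    ∫ x, ∑ ℓ : Fin n, inner ℝ (u ℓ x) (x - S^[(ℓ : ℕ) + 1] x) ∂μ =
      ∫ x, ∑ ℓ : Fin n, inner ℝ (u ℓ x) x ∂μ -
        ∫ x, ∑ ℓ : Fin n, inner ℝ (u ℓ x) (S^[(ℓ : ℕ) + 1] x) ∂μ := by
  rw [← integral_sub]
  · simp only [inner_sub_right, Finset.sum_sub_distrib]
  · exact integrable_finsetSum _ fun ℓ _ =>
      integrable_inner_field hμ hu hu_bdd hΩb ℓ measurable_id (Set.mapsTo_id _)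
  · exact integrable_finsetSum _ fun ℓ _ => integrable_inner_field hμ hu hu_bdd hΩb ℓ
      (hS.2.1.measurable.iterate _) (hS.1.iterate _)

theorem integral_sq_dist_eq [IsProbabilityMeasure μ] (hμ : ∀ᵐ x ∂μ, x ∈ Ω)
    (hu : ∀ ℓ, AEMeasurable (u ℓ) μ) (hu_bdd : ∀ ℓ, ∃ C : ℝ, ∀ x ∈ Ω, ‖u ℓ x‖ ≤ C)
    (hΩb : Bornology.IsBounded Ω) {S : E d → E d} (hS : S ∈ involutions n Ω μ) :
    ∫ x, ∑ ℓ : Fin n, ‖u ℓ x - S^[(ℓ : ℕ) + 1] x‖ ^ 2 ∂μ =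
      ∑ ℓ : Fin n, ∫ x, ‖u ℓ x - x‖ ^ 2 ∂μ +
        2 * ∫ x, ∑ ℓ : Fin n, inner ℝ (u ℓ x) (x - S^[(ℓ : ℕ) + 1] x) ∂μ := by
  obtain ⟨R, hR⟩ := hΩb.exists_norm_le
  have hi0 : ∀ ℓ, Integrable (fun x => inner ℝ (u ℓ x) x) μ := fun ℓ =>
    integrable_inner_field hμ hu hu_bdd hΩb ℓ measurable_id (Set.mapsTo_id _)
  have hi1 : ∀ ℓ : Fin n, Integrable (fun x => inner ℝ (u ℓ x) (S^[(ℓ : ℕ) + 1] x)) μ := fun ℓ =>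
    integrable_inner_field hμ hu hu_bdd hΩb ℓ (hS.2.1.measurable.iterate _) (hS.1.iterate _)
  have hi2 : Integrable (fun x : E d => ‖x‖ ^ 2) μ := integrable_sq_of_bdd hμ aemeasurable_id hR
  have hi3 : ∀ k : ℕ, Integrable (fun x : E d => ‖S^[k] x‖ ^ 2) μ := fun k =>
    integrable_sq_of_bdd hμ (hS.2.1.measurable.iterate _).aemeasurable
      fun x hx => hR _ (hS.1.iterate k hx)
  have hi4 : ∀ ℓ, Integrable (fun x => ‖u ℓ x - x‖ ^ 2) μ := fun ℓ => by
    obtain ⟨C, hC⟩ := hu_bdd ℓ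
    exact integrable_sq_of_bdd hμ ((hu ℓ).sub aemeasurable_id) (C := C + R) fun x hx =>
      (norm_sub_le _ _).trans (add_le_add (hC x hx) (hR x hx))
  have hk : ∀ k : ℕ, ∫ x, ‖S^[k] x‖ ^ 2 ∂μ = ∫ x, ‖x‖ ^ 2 ∂μ := by
    intro k
    have hp := hS.2.1.iterate k
    have h := integral_map (μ := μ) hp.aemeasurable (f := fun x : E d => ‖x‖ ^ 2)
      (by fun_prop)
    rw [hp.map_eq] at h
    exact h.symm
  -- The last bracket integrates to zero because `S` preserves `μ`.
  have hpt : ∀ (ℓ : Fin n) x, ‖u ℓ x - S^[(ℓ : ℕ) + 1] x‖ ^ 2 = ‖u ℓ x - x‖ ^ 2 +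
      2 * (inner ℝ (u ℓ x) x - inner ℝ (u ℓ x) (S^[(ℓ : ℕ) + 1] x)) +
      (‖S^[(ℓ : ℕ) + 1] x‖ ^ 2 - ‖x‖ ^ 2) := by
    intro ℓ x
    rw [norm_sub_sq_real, norm_sub_sq_real]
    ring
  have hd : ∀ ℓ : Fin n, Integrable
      (fun x => inner ℝ (u ℓ x) x - inner ℝ (u ℓ x) (S^[(ℓ : ℕ) + 1] x)) μ :=
    fun ℓ => (hi0 ℓ).sub (hi1 ℓ)
  have he : ∀ ℓ : Fin n, Integrable (fun x => ‖u ℓ x - x‖ ^ 2 +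
      2 * (inner ℝ (u ℓ x) x - inner ℝ (u ℓ x) (S^[(ℓ : ℕ) + 1] x))) μ :=
    fun ℓ => (hi4 ℓ).add ((hd ℓ).const_mul 2)
  have hf : ∀ ℓ : Fin n, Integrable (fun x => ‖S^[(ℓ : ℕ) + 1] x‖ ^ 2 - ‖x‖ ^ 2) μ :=
    fun ℓ => (hi3 _).sub hi2
  simp only [hpt, inner_sub_right]
  rw [integral_finsetSum _ fun ℓ _ => hd ℓ, integral_finsetSum, Finset.mul_sum,
    ← Finset.sum_add_distrib]
  swap
  · exact fun ℓ _ => (he ℓ).add (hf ℓ)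
  refine Finset.sum_congr rfl fun ℓ _ => ?_
  rw [integral_add (he ℓ) (hf ℓ), integral_add (hi4 ℓ) ((hd ℓ).const_mul 2),
    integral_sub (hi3 _) hi2, hk, integral_const_mul]
  ring

end Plans

end NMonotone

namespace NMonotone

/-! ### Cyclic shifts of disjoint balls -/

section BallShift

open Filter Topology Metric

variable {d n : ℕ} {Ω : Set (E d)} {u : Fin n → E d → E d} {w : Fin (n + 1) → E d} {δ : ℝ}

/-- The map which translates the ball around `w i` to the ball around `w (i + 1)`. -/
noncomputable def ballShift (w : Fin (n + 1) → E d) (δ : ℝ) (x : E d) : E d :=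
  x + ∑ i, (closedBall (w i) δ).indicator (fun _ => w (i + 1) - w i) x

theorem measurable_ballShift : Measurable (ballShift w δ) :=
  measurable_id.add <| Finset.measurable_fun_sum _ fun _ _ =>
    measurable_const.indicator measurableSet_closedBall

theorem ballShift_of_mem
    (hw : Pairwise fun i j => Disjoint (closedBall (w i) δ) (closedBall (w j) δ))
    {i : Fin (n + 1)} {x : E d} (hx : x ∈ closedBall (w i) δ) :
    ballShift w δ x = x + (w (i + 1) - w i) := by
  rw [ballShift, Finset.sum_eq_single i]
  · rw [Set.indicator_of_mem hx]
  · intro j _ hj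
    exact Set.indicator_of_notMem (fun h => Set.disjoint_left.1 (hw hj) h hx) _
  · simp

theorem ballShift_of_notMem {x : E d} (hx : ∀ i, x ∉ closedBall (w i) δ) :
    ballShift w δ x = x := by
  simp [ballShift, Set.indicator_of_notMem (hx _)]

theorem add_sub_mem_closedBall {i j : Fin (n + 1)} {x : E d} :
    x + (w j - w i) ∈ closedBall (w j) δ ↔ x ∈ closedBall (w i) δ := by
  rw [mem_closedBall, mem_closedBall, dist_eq_norm, dist_eq_norm]
  congr! 2
  abel

theorem ballShift_iterate_of_mem
    (hw : Pairwise fun i j => Disjoint (closedBall (w i) δ) (closedBall (w j) δ))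
    {i : Fin (n + 1)} {x : E d} (hx : x ∈ closedBall (w i) δ) (k : ℕ) :
    (ballShift w δ)^[k] x = x + (w (i + Fin.ofNat (n + 1) k) - w i) := by
  induction k with
  | zero => simp
  | succ k ih =>
    rw [Function.iterate_succ_apply', ih, ballShift_of_mem hw (add_sub_mem_closedBall.2 hx)]
    have : i + Fin.ofNat (n + 1) k + 1 = i + Fin.ofNat (n + 1) (k + 1) := by
      rw [add_assoc]; congr 1; ext; simp [Fin.val_add]
    rw [this]
    abel

theorem ballShift_iterate_succ_of_mem
    (hw : Pairwise fun i j => Disjoint (closedBall (w i) δ) (closedBall (w j) δ))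
    {i : Fin (n + 1)} {x : E d} (hx : x ∈ closedBall (w i) δ) (ℓ : Fin n) :
    (ballShift w δ)^[(ℓ : ℕ) + 1] x = x + (w (i + ℓ.succ) - w i) := by
  rw [ballShift_iterate_of_mem hw hx]
  congr 4
  ext
  simp [Nat.mod_eq_of_lt]

/-- Split a set along the disjoint balls and their complement: the map is a translation on each
ball, permutes the balls cyclically, and is the identity elsewhere. -/
theorem measurePreserving_ballShift
    (hw : Pairwise fun i j => Disjoint (closedBall (w i) δ) (closedBall (w j) δ)) :
    MeasurePreserving (ballShift w δ) (volume : Measure (E d)) volume := by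
  refine ⟨measurable_ballShift, Measure.ext fun s hs => ?_⟩
  rw [Measure.map_apply measurable_ballShift hs]
  have hU : MeasurableSet (⋃ i, closedBall (w i) δ) :=
    MeasurableSet.iUnion fun _ => measurableSet_closedBall
  have hdec : ∀ t : Set (E d), MeasurableSet t → volume t =
      ∑ i, volume (t ∩ closedBall (w i) δ) + volume (t \ ⋃ i, closedBall (w i) δ) := by
    intro t ht
    rw [← measure_inter_add_sdiff t hU, Set.inter_iUnion, measure_iUnion, tsum_fintype]
    · exact fun i j hij => (hw hij).mono Set.inter_subset_right Set.inter_subset_right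
    · exact fun i => ht.inter measurableSet_closedBall
  rw [hdec _ (measurable_ballShift hs), hdec s hs]
  congr 1
  · rw [← Fintype.sum_equiv (Equiv.addRight (1 : Fin (n + 1)))
      (fun i => volume (s ∩ closedBall (w (i + 1)) δ)) (fun i => volume (s ∩ closedBall (w i) δ))
      fun _ => rfl]
    refine Finset.sum_congr rfl fun i _ => ?_
    rw [← measure_preimage_add_right volume (w (i + 1) - w i) (s ∩ closedBall (w (i + 1)) δ)]
    congr 1
    ext x
    simp only [Set.mem_inter_iff, Set.mem_preimage, add_sub_mem_closedBall]
    constructor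
    · rintro ⟨h1, h2⟩
      rw [ballShift_of_mem hw h2] at h1
      exact ⟨h1, h2⟩
    · rintro ⟨h1, h2⟩
      rw [ballShift_of_mem hw h2]
      exact ⟨h1, h2⟩
  · congr 1
    ext x
    simp only [Set.mem_sdiff, Set.mem_preimage, Set.mem_iUnion, not_exists]
    constructor
    · rintro ⟨h1, h2⟩
      rw [ballShift_of_notMem h2] at h1
      exact ⟨h1, h2⟩
    · rintro ⟨h1, h2⟩
      rw [ballShift_of_notMem h2]
      exact ⟨h1, h2⟩

theorem ballShift_mem_involutions (hΩo : IsOpen Ω)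
    (hw : Pairwise fun i j => Disjoint (closedBall (w i) δ) (closedBall (w j) δ))
    (hsub : ∀ i, closedBall (w i) δ ⊆ Ω) :
    ballShift w δ ∈ involutions n Ω (normLebesgue Ω) := by
  have hiff : ∀ x, ballShift w δ x ∈ Ω ↔ x ∈ Ω := by
    intro x
    by_cases h : ∃ i, x ∈ closedBall (w i) δ
    · obtain ⟨i, hi⟩ := h
      refine iff_of_true ?_ (hsub i hi)
      rw [ballShift_of_mem hw hi]
      exact hsub (i + 1) (add_sub_mem_closedBall.2 hi)
    · rw [ballShift_of_notMem (not_exists.1 h)]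
  have hpre : ballShift w δ ⁻¹' Ω = Ω := Set.ext hiff
  refine ⟨fun x hx => (hiff x).2 hx, ?_, ae_of_all _ fun x => ?_⟩
  · have h := (measurePreserving_ballShift hw).restrict_preimage hΩo.measurableSet
    rw [hpre] at h
    exact h.smul_measure _
  · by_cases h : ∃ i, x ∈ closedBall (w i) δ
    · obtain ⟨i, hi⟩ := h
      rw [ballShift_iterate_of_mem hw hi]
      simp
    · exact Function.iterate_fixed (ballShift_of_notMem (not_exists.1 h)) _

/-- The displacement is constant on each ball, so only the mean of `u` over the ball enters. All
balls have the same volume, which factors out. -/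
theorem integral_ballShift
    (hU : ∀ ℓ, Integrable (Ω.indicator (u ℓ))) (hδ : 0 < δ)
    (hw : Pairwise fun i j => Disjoint (closedBall (w i) δ) (closedBall (w j) δ))
    (hsub : ∀ i, closedBall (w i) δ ⊆ Ω) :
    ∫ x, ∑ ℓ : Fin n, inner ℝ (u ℓ x) (x - (ballShift w δ)^[(ℓ : ℕ) + 1] x) ∂normLebesgue Ω =
      (volume Ω)⁻¹.toReal * (volume.real (closedBall (0 : E d) δ) * ∑ i, ∑ ℓ : Fin n,
        inner ℝ (⨍ x in closedBall (w i) δ, Ω.indicator (u ℓ) x) (w i - w (i + ℓ.succ))) := by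
  have hpt : ∀ x, ∑ ℓ : Fin n, inner ℝ (u ℓ x) (x - (ballShift w δ)^[(ℓ : ℕ) + 1] x) =
      ∑ i, (closedBall (w i) δ).indicator
        (fun x => ∑ ℓ : Fin n, inner ℝ (w i - w (i + ℓ.succ)) (Ω.indicator (u ℓ) x)) x := by
    intro x
    by_cases h : ∃ i, x ∈ closedBall (w i) δ
    · obtain ⟨i, hi⟩ := h
      rw [Finset.sum_eq_single i, Set.indicator_of_mem hi]
      · refine Finset.sum_congr rfl fun ℓ _ => ?_
        rw [ballShift_iterate_succ_of_mem hw hi, Set.indicator_of_mem (hsub i hi), real_inner_comm]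
        congr 1
        abel
      · intro j _ hj
        exact Set.indicator_of_notMem (fun h => Set.disjoint_left.1 (hw hj) h hi) _
      · simp
    · have h' := not_exists.1 h
      simp [Set.indicator_of_notMem (h' _), Function.iterate_fixed (ballShift_of_notMem h')]
  have hint : ∀ i, Integrable
      (fun x => ∑ ℓ : Fin n, inner ℝ (w i - w (i + ℓ.succ)) (Ω.indicator (u ℓ) x)) := fun i =>
    integrable_finsetSum _ fun ℓ _ => (hU ℓ).const_inner _
  simp only [hpt, normLebesgue, ProbabilityTheory.cond, integral_smul_measure, smul_eq_mul]
  congr 1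
  rw [integral_finsetSum _ fun i _ => ((hint i).indicator measurableSet_closedBall).restrict,
    Finset.mul_sum]
  refine Finset.sum_congr rfl fun i _ => ?_
  rw [setIntegral_indicator measurableSet_closedBall, Set.inter_eq_right.2 (hsub i),
    integral_finsetSum _ fun ℓ _ => ((hU ℓ).const_inner _).restrict, Finset.mul_sum]
  refine Finset.sum_congr rfl fun ℓ _ => ?_
  rw [integral_inner (hU ℓ).restrict, setAverage_eq, real_inner_smul_left, real_inner_comm,
    measureReal_def, measureReal_def, Measure.addHaar_closedBall_center volume (w i),
    mul_inv_cancel_left₀]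
  exact (ENNReal.toReal_pos (measure_closedBall_pos volume _ hδ).ne'
    measure_closedBall_lt_top.ne).ne'

/-- Fields whose cyclic rearrangements never beat the identity are jointly monotone. -/
theorem exists_jointlyMonotoneOn (hΩo : IsOpen Ω) (hΩb : Bornology.IsBounded Ω)
    (hne : Ω.Nonempty) (hu_meas : ∀ ℓ, AEMeasurable (u ℓ) (volume.restrict Ω))
    (hu_bdd : ∀ ℓ, ∃ C : ℝ, ∀ x ∈ Ω, ‖u ℓ x‖ ≤ C)
    (h : ∀ S ∈ involutions n Ω (normLebesgue Ω),
      0 ≤ ∫ x, ∑ ℓ : Fin n, inner ℝ (u ℓ x) (x - S^[(ℓ : ℕ) + 1] x) ∂normLebesgue Ω) :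
    ∃ Ω₀ : Set (E d), volume Ω₀ = 0 ∧ JointlyMonotoneOn u (Ω \ Ω₀) := by
  have hU := integrable_indicator_field hΩo hΩb hu_meas hu_bdd
  have hae := ae_all_iff.2 fun ℓ => ae_tendsto_average_shift (hU ℓ).locallyIntegrable
  refine ⟨_, hae, fun x hx => ?_⟩
  -- For `d = 0` there is no unit vector to separate the balls, but every term is zero.
  rcases subsingleton_or_nontrivial (E d) with hs | hs
  · simp [Subsingleton.elim (α := E d) _ 0]
  have hxΩ : ∀ i, x i ∈ Ω := fun i => (hx i).1
  have hlim : ∀ i ℓ (v : E d), Tendsto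
      (fun δ : ℝ => ⨍ z in closedBall (x i + δ • v) δ, Ω.indicator (u ℓ) z)
      (𝓝[>] 0) (𝓝 (Ω.indicator (u ℓ) (x i))) := by
    intro i ℓ v
    have := (hx i).2
    simp only [Set.mem_compl_iff, Set.mem_ofPred_eq, not_not] at this
    exact this ℓ v
  obtain ⟨e, he⟩ := exists_norm_eq (E d) zero_le_one
  -- The points `x i` may coincide. Offsets `4 i δ` along `e` put such centres at least `4 δ > 2 δ`
  -- apart, and being proportional to `δ` they leave the averages convergent.
  set w : ℝ → Fin (n + 1) → E d := fun δ i => x i + δ • ((4 * (i : ℕ) : ℝ) • e) with hw_def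
  have hwlim : ∀ i, Tendsto (fun δ => w δ i) (𝓝[>] 0) (𝓝 (x i)) := by
    intro i
    have : Continuous fun δ => w δ i := by fun_prop
    have h0 := this.tendsto 0
    simp only [hw_def, zero_smul, add_zero] at h0
    exact h0.mono_left nhdsWithin_le_nhds
  have hid : Tendsto (fun δ : ℝ => δ) (𝓝[>] 0) (𝓝 0) := tendsto_id.mono_left nhdsWithin_le_nhds
  have hδpos : ∀ᶠ δ : ℝ in 𝓝[>] 0, 0 < δ := self_mem_nhdsWithin
  have hdisj : ∀ᶠ δ in 𝓝[>] (0 : ℝ),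
      Pairwise fun i j => Disjoint (closedBall (w δ i) δ) (closedBall (w δ j) δ) := by
    refine eventually_all.2 fun i => eventually_all.2 fun j => ?_
    by_cases hij : i = j
    · exact Eventually.of_forall fun _ h => absurd hij h
    by_cases hxij : x i = x j
    · filter_upwards [hδpos] with δ hδ _
      refine closedBall_disjoint_closedBall ?_
      have h1 : (1 : ℝ) ≤ |((i : ℕ) : ℝ) - (j : ℕ)| := by
        have hne : ((i : ℕ) : ℤ) - (j : ℕ) ≠ 0 := by
          intro h0; apply hij; ext; omega
        exact_mod_cast Int.one_le_abs hne
      have h2 : dist (w δ i) (w δ j) = δ * (4 * |((i : ℕ) : ℝ) - (j : ℕ)|) := by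
        rw [dist_eq_norm, hw_def]
        simp only [hxij, add_sub_add_left_eq_sub, ← smul_sub, ← sub_smul, ← mul_sub, norm_smul, he]
        rw [Real.norm_eq_abs, Real.norm_eq_abs, abs_mul, abs_of_pos hδ]
        simp
      rw [h2]
      nlinarith
    · have h1 : Tendsto (fun δ : ℝ => dist (w δ i) (w δ j) - (δ + δ)) (𝓝[>] 0)
          (𝓝 (dist (x i) (x j) - (0 + 0))) := ((hwlim i).dist (hwlim j)).sub (hid.add hid)
      have h2 : 0 < dist (x i) (x j) - (0 + 0) := by simpa using dist_pos.2 hxij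
      filter_upwards [h1.eventually (lt_mem_nhds h2)] with δ hδ _
      exact closedBall_disjoint_closedBall (by linarith)
  have hsub : ∀ᶠ δ in 𝓝[>] (0 : ℝ), ∀ i, closedBall (w δ i) δ ⊆ Ω := by
    refine eventually_all.2 fun i => ?_
    obtain ⟨ρ, hρ, hball⟩ := Metric.isOpen_iff.1 hΩo (x i) (hxΩ i)
    have h1 : Tendsto (fun δ : ℝ => δ + dist (w δ i) (x i)) (𝓝[>] 0)
        (𝓝 (0 + dist (x i) (x i))) := hid.add ((hwlim i).dist tendsto_const_nhds)
    rw [dist_self, add_zero] at h1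
    filter_upwards [h1.eventually (gt_mem_nhds hρ)] with δ hδ
    refine (closedBall_subset_ball' ?_).trans hball
    exact hδ
  have hconv : Tendsto (fun δ : ℝ => ∑ i, ∑ ℓ : Fin n,
      inner ℝ (⨍ z in closedBall (w δ i) δ, Ω.indicator (u ℓ) z) (w δ i - w δ (i + ℓ.succ)))
      (𝓝[>] 0) (𝓝 (∑ i, ∑ ℓ : Fin n, inner ℝ (Ω.indicator (u ℓ) (x i)) (x i - x (i + ℓ.succ)))) :=
    tendsto_finsetSum _ fun i _ => tendsto_finsetSum _ fun ℓ _ =>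
      (hlim i ℓ _).inner ((hwlim i).sub (hwlim _))
  simp only [Set.indicator_of_mem (hxΩ _)] at hconv
  refine ge_of_tendsto hconv ?_
  filter_upwards [hδpos, hdisj, hsub] with δ hδ hd hs
  have h1 := h _ (ballShift_mem_involutions hΩo hd hs)
  rw [integral_ballShift hU hδ hd hs] at h1
  have hv : 0 < (volume Ω)⁻¹.toReal := ENNReal.toReal_pos
    (ENNReal.inv_ne_zero.2 hΩb.measure_lt_top.ne)
    (ENNReal.inv_ne_top.2 (hΩo.measure_pos volume hne).ne')
  have hb : 0 < volume.real (closedBall (0 : E d) δ) :=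
    ENNReal.toReal_pos (measure_closedBall_pos volume _ hδ).ne' measure_closedBall_lt_top.ne
  exact nonneg_of_mul_nonneg_right (nonneg_of_mul_nonneg_right h1 hv) hb

end BallShift

end NMonotone

namespace NMonotone

/-! ### Integrals of extended-real functions and duality -/

section Duality

open Filter Topology

variable {d n : ℕ} {Ω : Set (E d)} {u : Fin n → E d → E d} {μ : Measure (E d)}

/-- No measurability is required, so the integrals of `L_H` can be compared directly for arbitrary
`H`. -/
theorem extIntegral_mono_ae {X : Type*} [MeasurableSpace X] {μ : Measure X} {f g : X → EReal}
    (h : ∀ᵐ x ∂μ, f x ≤ g x) : extIntegral μ f ≤ extIntegral μ g :=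
  EReal.sub_le_sub
    (EReal.coe_ennreal_le_coe_ennreal_iff.2 <| lintegral_mono_ae <| h.mono fun _ hx =>
      EReal.toENNReal_le_toENNReal hx)
    (EReal.coe_ennreal_le_coe_ennreal_iff.2 <| lintegral_mono_ae <| h.mono fun _ hx =>
      EReal.toENNReal_le_toENNReal (EReal.neg_le_neg_iff.2 hx))

theorem extIntegral_coe {X : Type*} [MeasurableSpace X] {μ : Measure X} {f : X → ℝ}
    (hf : Integrable f μ) : extIntegral μ (fun x => (f x : EReal)) = (∫ x, f x ∂μ : ℝ) := by
  have h1 : ∫⁻ x, ENNReal.ofReal (f x) ∂μ ≠ ∞ := hf.lintegral_lt_top.ne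
  have h2 : ∫⁻ x, ENNReal.ofReal (-f x) ∂μ ≠ ∞ := hf.neg.lintegral_lt_top.ne
  rw [integral_eq_lintegral_pos_part_sub_lintegral_neg_part hf, EReal.coe_sub,
    EReal.coe_ennreal_toReal h1, EReal.coe_ennreal_toReal h2]
  simp only [extIntegral, ← EReal.coe_neg, EReal.real_coe_toENNReal]

theorem diag_le_legendre {H : (Fin (n + 1) → E d) → ℝ} (hH : H ∈ antisymmetricHamiltonians n Ω)
    {x : E d} (hx : x ∈ Ω) (p : Fin n → E d) :
    ((∑ ℓ, inner ℝ (p ℓ) x : ℝ) : EReal) ≤ legendre Ω H x p := by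
  have h0 : H (fun _ => x) = 0 := by
    have := hH.2 (fun _ => x) fun _ => hx
    rw [sum_range_cyc] at this
    simp only [rot_const, Finset.sum_const, Finset.card_univ, Fintype.card_fin, nsmul_eq_mul,
      mul_eq_zero] at this
    exact this.resolve_left (by positivity)
  have h := le_iSup₂ (f := fun (y : Fin n → E d) (_ : y ∈ power Ω n) =>
    (((∑ i, inner ℝ (p i) (y i)) - H (Fin.cons x y) : ℝ) : EReal)) (fun _ => x) fun _ => hx
  simpa [cons_const, h0, legendre] using h

theorem legendre_le_diag {H : (Fin (n + 1) → E d) → ℝ} {x : E d} {p : Fin n → E d}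
    (h : ∀ y ∈ power Ω n, ∑ ℓ, inner ℝ (p ℓ) (y ℓ - x) ≤ H (Fin.cons x y)) :
    legendre Ω H x p ≤ ((∑ ℓ, inner ℝ (p ℓ) x : ℝ) : EReal) := by
  refine iSup₂_le fun y hy => EReal.coe_le_coe_iff.2 ?_
  have := h y hy
  simp only [inner_sub_right, Finset.sum_sub_distrib] at this
  linarith

/-- The antisymmetrization `H - N⁻¹ ∑ H ∘ σ ^ i`. -/
noncomputable def antisymmetrize (H : (Fin (n + 1) → E d) → ℝ) (x : Fin (n + 1) → E d) : ℝ :=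
  H x - (∑ i : Fin (n + 1), H (rot i x)) / (n + 1)

theorem antisymmetrize_mem {H : (Fin (n + 1) → E d) → ℝ}
    (hc : ContinuousOn H (power Ω (n + 1))) :
    antisymmetrize H ∈ antisymmetricHamiltonians n Ω := by
  refine ⟨hc.sub (ContinuousOn.div_const (continuousOn_finsetSum _ fun i _ => ?_) _),
    fun x _ => ?_⟩
  · have hr : Continuous (rot i : (Fin (n + 1) → E d) → _) :=
      continuous_pi fun _ => continuous_apply _
    exact hc.comp hr.continuousOn fun x hx => rot_mem_power hx i
  · rw [sum_range_cyc]
    have h : ∀ i : Fin (n + 1), ∑ j : Fin (n + 1), H (rot j (rot i x)) =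
        ∑ j : Fin (n + 1), H (rot j x) := by
      intro i
      simp only [rot_rot]
      exact Fintype.sum_equiv (Equiv.addRight i) _ _ fun _ => rfl
    simp only [antisymmetrize, Finset.sum_sub_distrib, h, Finset.sum_const, Finset.card_univ,
      Fintype.card_fin, nsmul_eq_mul]
    push_cast
    field_simp
    simp

theorem le_antisymmetrize {H : (Fin (n + 1) → E d) → ℝ} (hH : SubAntisymmetric Ω H)
    {x : Fin (n + 1) → E d} (hx : x ∈ power Ω (n + 1)) : H x ≤ antisymmetrize H x := by
  have := subAntisymmetric_iff.1 hH x hx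
  rw [antisymmetrize, le_sub_self_iff]
  exact div_nonpos_of_nonpos_of_nonneg this (by positivity)

theorem iInf_extIntegral_legendre_eq (hμ : ∀ᵐ x ∂μ, x ∈ Ω)
    (hint : Integrable (fun x => ∑ ℓ, inner ℝ (u ℓ x) x) μ)
    (hex : ∃ H ∈ antisymmetricHamiltonians n Ω, ∀ᵐ x ∂μ, ∀ y ∈ power Ω n,
      ∑ ℓ, inner ℝ (u ℓ x) (y ℓ - x) ≤ H (Fin.cons x y)) :
    ⨅ H ∈ antisymmetricHamiltonians n Ω,
      extIntegral μ (fun x => legendre Ω H x (fun ℓ => u ℓ x)) =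
      ((∫ x, ∑ ℓ, inner ℝ (u ℓ x) x ∂μ : ℝ) : EReal) := by
  rw [← extIntegral_coe hint]
  refine le_antisymm ?_ (le_iInf₂ fun H hH => extIntegral_mono_ae <| hμ.mono fun x hx =>
    diag_le_legendre hH hx _)
  obtain ⟨H, hH, hle⟩ := hex
  exact (iInf₂_le H hH).trans (extIntegral_mono_ae <| hle.mono fun x hx => legendre_le_diag hx)

/-- A convex function lies above its tangent. -/
theorem fderiv_le_of_convexOn {F : Type*} [NormedAddCommGroup F] [NormedSpace ℝ F] {s : Set F}
    {h : F → ℝ} (hc : ConvexOn ℝ s h) {a b : F} (ha : a ∈ s) (hb : b ∈ s) {L : F →L[ℝ] ℝ}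
    (hL : HasFDerivAt h L a) : L (b - a) ≤ h b - h a := by
  refine le_of_tendsto (hL.hasLineDerivAt (b - a)).tendsto_slope_zero_right ?_
  filter_upwards [Ioo_mem_nhdsGT (show (0 : ℝ) < 1 by norm_num)] with t ht
  have h1 := hc.2 ha hb (sub_nonneg.2 ht.2.le) ht.1.le (by ring)
  have h2 : (1 - t) • a + t • b = a + t • (b - a) := by
    rw [sub_smul, one_smul, smul_sub]; abel
  rw [h2] at h1
  simp only [smul_eq_mul] at h1 ⊢
  rw [inv_mul_le_iff₀ ht.1]
  linarith

/-- Add the minorants at the `N` rotations of a tuple: their sum lies below the cyclic sum of `H`,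
which is nonpositive. -/
theorem jointlyMonotoneOn_of_minorant {H : (Fin (n + 1) → E d) → ℝ} {A : Set (E d)}
    (hH : SubAntisymmetric Ω H) (hAΩ : A ⊆ Ω)
    (hlow : ∀ z ∈ A, ∀ y ∈ power Ω n, ∑ ℓ, inner ℝ (u ℓ z) (y ℓ - z) ≤ H (Fin.cons z y)) :
    JointlyMonotoneOn u A := by
  intro x hx
  have hxΩ : x ∈ power Ω (n + 1) := fun i => hAΩ (hx i)
  have h1 := subAntisymmetric_iff.1 hH x hxΩ
  have h2 : ∑ i, ∑ ℓ : Fin n, inner ℝ (u ℓ (x i)) (x (i + ℓ.succ) - x i) ≤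
      ∑ i, H (rot i x) := by
    refine Finset.sum_le_sum fun i _ => ?_
    have := hlow (x i) (hx i) _ (tail_mem_power (rot_mem_power hxΩ i))
    have hc : (Fin.cons (x i) (Fin.tail (rot i x)) : Fin (n + 1) → E d) = rot i x := by
      conv_rhs => rw [← Fin.cons_self_tail (rot i x)]
      simp
    rw [hc] at this
    simpa [Fin.tail, add_comm i] using this
  have h3 : ∑ i, ∑ ℓ : Fin n, inner ℝ (u ℓ (x i)) (x i - x (i + ℓ.succ)) =
      -∑ i, ∑ ℓ : Fin n, inner ℝ (u ℓ (x i)) (x (i + ℓ.succ) - x i) := by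
    simp only [← Finset.sum_neg_distrib, ← inner_neg_right, neg_sub]
  linarith

theorem le_of_hasDiagonalGradient {H : (Fin (n + 1) → E d) → ℝ} {x : E d} (hx : x ∈ Ω)
    (hconv : ConvexOn ℝ (power Ω n) (fun y => H (Fin.cons x y))) (h0 : H (fun _ => x) = 0)
    {p : Fin n → E d} (hp : HasDiagonalGradient H p x) {y : Fin n → E d} (hy : y ∈ power Ω n) :
    ∑ ℓ, inner ℝ (p ℓ) (y ℓ - x) ≤ H (Fin.cons x y) := by
  have := fderiv_le_of_convexOn hconv (fun _ => hx) hy hp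
  simpa [cons_const, h0] using this

theorem ae_normLebesgue_iff (hΩo : IsOpen Ω) (hΩb : Bornology.IsBounded Ω) {P : E d → Prop} :
    (∀ᵐ x ∂normLebesgue Ω, P x) ↔ ∀ᵐ x, x ∈ Ω → P x := by
  unfold normLebesgue ProbabilityTheory.cond
  rw [Measure.ae_ennreal_smul_measure_iff (ENNReal.inv_ne_zero.2 hΩb.measure_lt_top.ne),
    ae_restrict_iff' hΩo.measurableSet]

end Duality

end NMonotone

namespace NMonotone

/-! ### Consequences of joint monotonicity -/

section Consequences

variable {d n : ℕ} {Ω : Set (E d)} {u : Fin n → E d → E d}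

theorem exists_uniform_bounds (hΩb : Bornology.IsBounded Ω)
    (hu_bdd : ∀ ℓ, ∃ C : ℝ, ∀ x ∈ Ω, ‖u ℓ x‖ ≤ C) (Ω₀ : Set (E d)) :
    ∃ C R : ℝ, (∀ ℓ, ∀ z ∈ Ω \ Ω₀, ‖u ℓ z‖ ≤ C) ∧ ∀ z ∈ Ω \ Ω₀, ‖z‖ ≤ R := by
  choose C hC using hu_bdd
  obtain ⟨R, hR⟩ := hΩb.exists_norm_le
  refine ⟨∑ ℓ, |C ℓ|, R, fun ℓ z hz => ?_, fun z hz => hR z hz.1⟩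
  exact (hC ℓ z hz.1).trans ((le_abs_self _).trans
    (Finset.single_le_sum (f := fun ℓ => |C ℓ|) (fun _ _ => abs_nonneg _) (Finset.mem_univ ℓ)))

theorem exists_subSaddle_of_jointlyMonotoneOn (hΩo : IsOpen Ω) (hΩ : Convex ℝ Ω)
    (hΩb : Bornology.IsBounded Ω) (hu_meas : ∀ ℓ, AEMeasurable (u ℓ) (volume.restrict Ω))
    (hu_bdd : ∀ ℓ, ∃ C : ℝ, ∀ x ∈ Ω, ‖u ℓ x‖ ≤ C) {Ω₀ : Set (E d)} (h0 : volume Ω₀ = 0)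
    (hmono : JointlyMonotoneOn u (Ω \ Ω₀)) :
    ∃ H : (Fin (n + 1) → E d) → ℝ,
      SubAntisymmetric Ω H ∧
      (∀ y ∈ power Ω n, ConcaveOn ℝ Ω (fun x => H (Fin.cons x y))) ∧
      (∀ x ∈ Ω, ConvexOn ℝ (power Ω n) (fun y => H (Fin.cons x y))) ∧
      (∀ x ∈ Ω, H (fun _ => x) = 0) ∧
      (∀ᵐ x ∂normLebesgue Ω, HasDiagonalGradient H (fun ℓ => u ℓ x) x) ∧
      (∀ x ∈ power Ω (n + 1), (H x : EReal) + partialConcavification Ω H x = 0) := by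
  obtain ⟨C, R, hC, hR⟩ := exists_uniform_bounds hΩb hu_bdd Ω₀
  have hA := midpointDense_diff_null hΩo h0
  obtain ⟨H, hH, hge, hzero⟩ :=
    (generated_isSubSaddle hΩ hA hC hR hmono).exists_ge_add_partialConcavification_eq_zero hΩ
  refine ⟨H, hH.sub, hH.concave, hH.convex, fun x hx => ?_, ?_, hzero⟩
  -- Sub-antisymmetry gives `≤ 0` on the diagonal, and lying above `generated` gives `≥ 0`.
  · exact le_antisymm (SubAntisymmetric.diag_nonpos hH.sub hx)
      ((generated_diag_nonneg hA hC hR hx).trans (hge _ fun _ => hx))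
  · rw [ae_normLebesgue_iff hΩo hΩb]
    filter_upwards [ae_approxContinuous hΩo hΩb hu_meas hu_bdd h0,
      measure_eq_zero_iff_ae_notMem.1 h0] with x hx hx0 hxΩ
    exact hH.hasDiagonalGradient hΩo Set.sdiff_subset
      (fun z hz y hy => (le_generated hC hR hz y).trans (hge _ (cons_mem_power hz.1 hy)))
      ⟨hxΩ, hx0⟩ (hx hxΩ)

theorem exists_hamiltonian_of_jointlyMonotoneOn (hΩo : IsOpen Ω) (hΩ : Convex ℝ Ω)
    (hΩb : Bornology.IsBounded Ω) (hu_bdd : ∀ ℓ, ∃ C : ℝ, ∀ x ∈ Ω, ‖u ℓ x‖ ≤ C)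
    {Ω₀ : Set (E d)} (h0 : volume Ω₀ = 0) (hmono : JointlyMonotoneOn u (Ω \ Ω₀)) :
    ∃ H ∈ antisymmetricHamiltonians n Ω, ∀ᵐ x ∂normLebesgue Ω, ∀ y ∈ power Ω n,
      ∑ ℓ, inner ℝ (u ℓ x) (y ℓ - x) ≤ H (Fin.cons x y) := by
  obtain ⟨C, R, hC, hR⟩ := exists_uniform_bounds hΩb hu_bdd Ω₀
  have hA := midpointDense_diff_null hΩo h0
  -- The generated function is used here rather than its improved majorant, since continuity is
  -- needed. Antisymmetrizing only raises it.
  refine ⟨_, antisymmetrize_mem (continuousOn_generated hΩ hΩo hA hC hR hmono), ?_⟩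
  rw [ae_normLebesgue_iff hΩo hΩb]
  filter_upwards [measure_eq_zero_iff_ae_notMem.1 h0] with x hx hxΩ y hy
  exact (le_generated hC hR ⟨hxΩ, hx⟩ y).trans
    (le_antisymmetrize (generated_isSubSaddle hΩ hA hC hR hmono).sub (cons_mem_power hxΩ hy))

end Consequences

end NMonotone

/-- Here `N = n + 1`, so `1 ≤ n` says `2 ≤ N`. -/
theorem theorem3 {d n : ℕ} (hn : 1 ≤ n) (Ω : Set (E d)) (hΩ_open : IsOpen Ω)
    (hΩ_conv : Convex ℝ Ω) (hΩ_bdd : Bornology.IsBounded Ω) (hΩ_ne : Ω.Nonempty)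
    (u : Fin n → E d → E d)
    (hu_meas : ∀ ℓ, AEMeasurable (u ℓ) (volume.restrict Ω))
    (hu_bdd : ∀ ℓ, ∃ C : ℝ, ∀ x ∈ Ω, ‖u ℓ x‖ ≤ C) :
    List.TFAE [
      -- (1)
      ∃ Ω₀ : Set (E d), volume Ω₀ = 0 ∧ JointlyMonotoneOn u (Ω \ Ω₀),
      -- (2)
      IsGLB (planCost u '' symmetricPlans n Ω (normLebesgue Ω)) 0 ∧
        (normLebesgue Ω).map (fun x => fun _ : Fin (n + 1) => x)
          ∈ symmetricPlans n Ω (normLebesgue Ω) ∧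
        planCost u ((normLebesgue Ω).map (fun x => fun _ : Fin (n + 1) => x)) = 0,
      -- (3)
      IsGLB ((fun S : E d → E d =>
          ∫ x, ∑ ℓ : Fin n, inner ℝ (u ℓ x) (x - S^[(ℓ : ℕ) + 1] x) ∂normLebesgue Ω) ''
        involutions n Ω (normLebesgue Ω)) 0,
      -- (4)
      IsGLB ((fun S : E d → E d =>
          ∫ x, ∑ ℓ : Fin n, ‖u ℓ x - S^[(ℓ : ℕ) + 1] x‖ ^ 2 ∂normLebesgue Ω) ''
        involutions n Ω (normLebesgue Ω))
        (∑ ℓ : Fin n, ∫ x, ‖u ℓ x - x‖ ^ 2 ∂normLebesgue Ω),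
      -- (5)
      ∃ H : (Fin (n + 1) → E d) → ℝ,
        SubAntisymmetric Ω H ∧
        (∀ y ∈ power Ω n, ConcaveOn ℝ Ω (fun x => H (Fin.cons x y))) ∧
        (∀ x ∈ Ω, ConvexOn ℝ (power Ω n) (fun y => H (Fin.cons x y))) ∧
        (∀ x ∈ Ω, H (fun _ => x) = 0) ∧
        (∀ᵐ x ∂normLebesgue Ω, HasDiagonalGradient H (fun ℓ => u ℓ x) x) ∧
        (∀ x ∈ power Ω (n + 1), (H x : EReal) + partialConcavification Ω H x = 0),
      -- (6)
      (⨅ H ∈ antisymmetricHamiltonians n Ω,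
          extIntegral (normLebesgue Ω) (fun x => legendre Ω H x (fun ℓ => u ℓ x))) =
        (⨆ S ∈ involutions n Ω (normLebesgue Ω),
          ((∫ x, ∑ ℓ : Fin n, inner ℝ (u ℓ x) (S^[(ℓ : ℕ) + 1] x) ∂normLebesgue Ω : ℝ) : EReal)) ∧
      (⨆ S ∈ involutions n Ω (normLebesgue Ω),
          ((∫ x, ∑ ℓ : Fin n, inner ℝ (u ℓ x) (S^[(ℓ : ℕ) + 1] x) ∂normLebesgue Ω : ℝ) : EReal)) =
        ((∫ x, ∑ ℓ : Fin n, inner ℝ (u ℓ x) x ∂normLebesgue Ω : ℝ) : EReal)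
    ] := by
  set μ := normLebesgue Ω with hμ_def
  have hprob : IsProbabilityMeasure μ := ProbabilityTheory.cond_isProbabilityMeasure_of_finite
    (hΩ_open.measure_pos volume hΩ_ne).ne' hΩ_bdd.measure_lt_top.ne
  have hμ : ∀ᵐ x ∂μ, x ∈ Ω :=
    (ae_normLebesgue_iff hΩ_open hΩ_bdd).2 (Filter.Eventually.of_forall fun _ hx => hx)
  have hu : ∀ ℓ, AEMeasurable (u ℓ) μ := fun ℓ => (hu_meas ℓ).smul_measure _
  have hcost : ∀ S ∈ involutions n Ω μ, _ := fun S hS =>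
    integral_inner_sub_eq hμ hu hu_bdd hΩ_bdd hS
  have hid : (id : E d → E d) ∈ involutions n Ω μ := id_mem_involutions
  have hback := @exists_jointlyMonotoneOn d n Ω u hΩ_open hΩ_bdd hΩ_ne hu_meas hu_bdd
  tfae_have 1 → 2 := by
    rintro ⟨Ω₀, h0, hmono⟩
    have hA : ∀ᵐ x ∂μ, x ∈ Ω \ Ω₀ := (ae_normLebesgue_iff hΩ_open hΩ_bdd).2
      ((measure_eq_zero_iff_ae_notMem.1 h0).mono fun _ hx hxΩ => ⟨hxΩ, hx⟩)
    have hdiag := diag_mem_symmetricPlans (n := n) hΩ_open hμ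
    have hzero := planCost_diag (n := n) hΩ_open hμ hu
    refine ⟨IsLeast.isGLB ⟨⟨_, hdiag, hzero⟩, ?_⟩, hdiag, hzero⟩
    rintro _ ⟨π, hπ, rfl⟩
    exact planCost_nonneg hΩ_bdd hu hu_bdd hA hmono hπ
  tfae_have 2 → 3 := by
    rintro ⟨hglb, -, -⟩
    refine IsLeast.isGLB ⟨⟨id, hid, by simp⟩, ?_⟩
    rintro _ ⟨S, hS, rfl⟩
    have := hglb.1 ⟨_, map_orbit_mem_symmetricPlans hΩ_open hμ hS, rfl⟩
    rwa [planCost_map_orbit hΩ_open hμ hu hS] at this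
  tfae_have 3 → 4 := by
    intro h
    refine IsLeast.isGLB ⟨⟨id, hid, ?_⟩, ?_⟩
    · simpa using integral_sq_dist_eq hμ hu hu_bdd hΩ_bdd hid
    · rintro _ ⟨S, hS, rfl⟩
      have h1 := h.1 ⟨S, hS, rfl⟩
      have h2 := integral_sq_dist_eq hμ hu hu_bdd hΩ_bdd hS
      simp only at h1 ⊢
      linarith
  tfae_have 4 → 1 := by
    intro h
    refine hback fun S hS => ?_
    have h1 := h.1 ⟨S, hS, rfl⟩
    have h2 := integral_sq_dist_eq hμ hu hu_bdd hΩ_bdd hS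
    simp only at h1
    linarith
  tfae_have 1 → 5 := by
    rintro ⟨Ω₀, h0, hmono⟩
    exact exists_subSaddle_of_jointlyMonotoneOn hΩ_open hΩ_conv hΩ_bdd hu_meas hu_bdd h0 hmono
  tfae_have 5 → 1 := by
    rintro ⟨H, hsub, -, hconv, hdiag, hgrad, -⟩
    -- `Ω₀` is the set of points of `Ω` where the gradient identity fails.
    refine ⟨_, (ae_normLebesgue_iff hΩ_open hΩ_bdd).1 hgrad, ?_⟩
    refine jointlyMonotoneOn_of_minorant hsub Set.sdiff_subset fun z hz y hy => ?_
    refine le_of_hasDiagonalGradient hz.1 (hconv z hz.1) (hdiag z hz.1) ?_ hy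
    have := hz.2
    simp only [Set.mem_compl_iff, Set.mem_ofPred_eq, not_not] at this
    exact this hz.1
  tfae_have 1 → 6 := by
    rintro ⟨Ω₀, h0, hmono⟩
    have hsup : (⨆ S ∈ involutions n Ω μ,
        ((∫ x, ∑ ℓ : Fin n, inner ℝ (u ℓ x) (S^[(ℓ : ℕ) + 1] x) ∂μ : ℝ) : EReal)) =
        ((∫ x, ∑ ℓ : Fin n, inner ℝ (u ℓ x) x ∂μ : ℝ) : EReal) := by
      refine le_antisymm (iSup₂_le fun S hS => EReal.coe_le_coe_iff.2 ?_) ?_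
      · have h3 := (tfae_2_to_3 (tfae_1_to_2 ⟨Ω₀, h0, hmono⟩)).1 ⟨S, hS, rfl⟩
        have := hcost S hS
        simp only at h3
        linarith
      · have := le_iSup₂ (f := fun (S : E d → E d) (_ : S ∈ involutions n Ω μ) =>
          ((∫ x, ∑ ℓ : Fin n, inner ℝ (u ℓ x) (S^[(ℓ : ℕ) + 1] x) ∂μ : ℝ) : EReal)) id hid
        simpa using this
    refine ⟨?_, hsup⟩
    rw [hsup]
    refine iInf_extIntegral_legendre_eq hμ (integrable_finsetSum _ fun ℓ _ =>
      integrable_inner_field hμ hu hu_bdd hΩ_bdd ℓ measurable_id (Set.mapsTo_id _)) ?_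
    exact exists_hamiltonian_of_jointlyMonotoneOn hΩ_open hΩ_conv hΩ_bdd hu_bdd h0 hmono
  tfae_have 6 → 1 := by
    rintro ⟨-, hsup⟩
    refine hback fun S hS => ?_
    have h1 := le_iSup₂ (f := fun (S : E d → E d) (_ : S ∈ involutions n Ω μ) =>
      ((∫ x, ∑ ℓ : Fin n, inner ℝ (u ℓ x) (S^[(ℓ : ℕ) + 1] x) ∂μ : ℝ) : EReal)) S hS
    rw [hsup] at h1
    have h2 := EReal.coe_le_coe_iff.1 h1
    rw [hcost S hS]
    exact sub_nonneg.2 h2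
  tfae_finish
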